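/- **Setting.** Let $n=(n_1,n_2)$, $m=(m_1,m_2)$ be pairs of nonnegative integers with $n_1+n_2=m_1+m_2$, and let $\lambda=(\lambda_1,\lambda_2)$, $z=(z_1,z_2)\in\mathbb C^2$ each have distinct coordinates. Let $p_1,p_2\in\mathbb C[x]$ have degrees $n_1,n_2$ and put $V=\langle p_1(x)e^{\lambda_1x},p_2(x)e^{\lambda_2x}\rangle$. Assume that $(V,z)$ is a *space of the $(\lambda,z,n,m)$-type*: for $a=1,2$ the set of orders of vanishing at $z_a$ of nonzero elements of $V$ is $\{0,1+m_a\}$, and at every other point of $\mathbb C$ it is $\{0,1\}$. Let $V^\star$ be the span of the functions $f/\mathrm{Wr}_V$, $f\in V$, where $\mathrm{Wr}_V$ is the Wronskian of a basis of $V$, and let $U$ be the *special bispectral dual* of $V$, the span of the functions $$u\mapsto\oint_{\gamma_a}\frac{e^{ux}f(x)}{(x-z_1)(x-z_2)}\,dx,\qquad f\in V^\star,\ a=1,2,$$ where $\gamma_a$ is a small circle around $z_a$. Write $U=\langle q_1(u)e^{z_1u},q_2(u)e^{z_2u}\rangle$ with polynomials $q_1,q_2$ of degrees $m_1,m_2$.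 Define $c_i,d_i,e_i$ by $$p_2(x)=\sum_{i=0}^{n_2}c_i\frac{(x-z_1)^{n_2-i}}{(n_2-i)!}\frac{(x-z_2)^i}{i!},\qquad p_1(x)=\sum_{i=0}^{n_1}d_i\frac{(x-z_1)^{n_1-i}}{(n_1-i)!}\frac{(x-z_2)^i}{i!},$$ $$q_2(u)=\sum_{i=0}^{m_2}e_i\frac{(u-\lambda_1)^{m_2-i}}{(m_2-i)!}\frac{(u-\lambda_2)^i}{i!}.$$ Let $\mathfrak{gl}_2$ act on $\mathbb C[x_1,x_2]$ by $E_{ij}\mapsto x_i\,\partial/\partial x_j$, let $L_k$ be the irreducible submodule of homogeneous polynomials of degree $k$, $v_k=x_1^k$, and let $(L_{m_1}\otimes L_{m_2})[n_1,n_2]$ be the subspace of $L_{m_1}\otimes L_{m_2}$ on which $E_{ii}$ acts as $n_i$, $i=1,2$. The *Weyl isomorphism* $W:(L_{m_1}\otimes L_{m_2})[n_1,n_2]\to(L_{m_1}\otimes L_{m_2})[n_2,n_1]$ is $$\frac{E_{21}^{n_2-i}v_{m_1}}{(n_2-i)!}\otimes\frac{E_{21}^iv_{m_2}}{i!}\mapsto\frac{E_{21}^{m_1-n_2+i}v_{m_1}}{(m_1-n_2+i)!}\otimes\frac{E_{21}^{m_2-i}v_{m_2}}{(m_2-i)!};$$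 it is induced by $x_1\leftrightarrow x_2$ in both factors. The *duality isomorphism* $\Delta:(L_{n_1}\otimes L_{n_2})[m_1,m_2]\to(L_{m_1}\otimes L_{m_2})[n_1,n_2]$ is induced by the isomorphisms of $\mathbb C[x_1,x_2]^{\otimes2}$ with $\mathbb C[x_{11},x_{12},x_{21},x_{22}]$ given by $g_1\otimes g_2\mapsto g_1(x_{11},x_{21})\,g_2(x_{12},x_{22})$ on the source and by $g_1\otimes g_2\mapsto g_1(x_{11},x_{12})\,g_2(x_{21},x_{22})$ on the target. For $M=(M_1,M_2)$, $k\ge0$ and a sequence $a=(a_i)$ put $$B_{M,k}(a)=\sum_{i=\max(0,k-M_1)}^{\min(M_2,k)}a_i\,\frac{E_{21}^{k-i}v_{M_1}}{(k-i)!}\otimes\frac{E_{21}^iv_{M_2}}{i!}\in L_{M_1}\otimes L_{M_2}.$$ For $\mu\in\mathbb C^2$, $y\in\mathbb C^2$ with distinct coordinates and $t\in\mathbb C^k$, let $$\Phi(t;\mu;y;M)=e^{\mu_1(M_1y_1+M_2y_2)+(\mu_2-\mu_1)\sum_jt_j}(y_1-y_2)^{M_1M_2}\prod_{j}(t_j-y_1)^{-M_1}(t_j-y_2)^{-M_2}\prod_{j<j'}(t_j-t_{j'})^2$$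 be the master function. Call $t$ *admissible* (for $y$) if its coordinates are distinct and different from $y_1,y_2$. The universal rational function is $$\omega_{y,M}(t)=B_{M,k}\big(C(t)\big),\qquad C_i(t)=\sum_{\sigma\in\Sigma_k}\ \prod_{j=1}^{k-i}\frac1{t_{\sigma(j)}-y_1}\ \prod_{j=k-i+1}^{k}\frac1{t_{\sigma(j)}-y_2};$$ when $t$ is an admissible critical point of $\Phi(\,\cdot\,;\mu;y;M)$ it is called a *Bethe vector*. **Statement.** 1. $W$ and $\Delta$ map the stated weight subspaces isomorphically onto each other, and $$B_{m,n_2}(c)\in(L_{m_1}\otimes L_{m_2})[n_1,n_2],\quad B_{m,n_1}(d)\in(L_{m_1}\otimes L_{m_2})[n_2,n_1],\quad B_{n,m_2}(e)\in(L_{n_1}\otimes L_{n_2})[m_1,m_2].$$ 2. These three vectors are identified, up to scalar factors, by $W$ and $\Delta$: there are a nonzero $w\in(L_{m_1}\otimes L_{m_2})[n_1,n_2]$ and $\kappa_1,\kappa_2,\kappa_3\in\mathbb C$ with $$B_{m,n_2}(c)=\kappa_1w,\qquad B_{m,n_1}(d)=\kappa_2\,W(w),\qquad \Delta\big(B_{n,m_2}(e)\big)=\kappa_3w.$$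 Moreover $\kappa_1\ne0$ if $p_2$ does not vanish at $z_1,z_2$; $\kappa_2\neq0$ if $p_1$ does not vanish at $z_1,z_2$; and $\kappa_3\ne0$ if $q_2$ does not vanish at $\lambda_1,\lambda_2$. 3. If the roots of $p_2$, listed as $t\in\mathbb C^{n_2}$, are admissible for $z$, then $t$ is a critical point of $\Phi(\,\cdot\,;\lambda_1,\lambda_2;z;m)$, and the Bethe vector $\omega_{z,m}(t)$ is nonzero and is a nonzero multiple of $B_{m,n_2}\big(((-1)^ic_i)_i\big)$. If the roots $s\in\mathbb C^{n_1}$ of $p_1$ are admissible for $z$, then $s$ is a critical point of $\Phi(\,\cdot\,;\lambda_2,\lambda_1;z;m)$, and $\omega_{z,m}(s)$ is nonzero and is a nonzero multiple of $B_{m,n_1}\big(((-1)^id_i)_i\big)$. If the roots $r\in\mathbb C^{m_2}$ of $q_2$ are admissible for $\lambda$, then $r$ is a critical point of $\Phi(\,\cdot\,;z;\lambda;n)$, and $\omega_{\lambda,n}(r)$ is nonzero and is a nonzero multiple of $B_{n,m_2}\big(((-1)^ie_i)_i\big)$. 4. The Bethe vectors are identified up to proportionality: $W(\omega_{z,m}(t))$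 is a nonzero multiple of $\omega_{z,m}(s)$ whenever $t$ and $s$ are admissible, and $\Delta(\omega_{\lambda,n}(r))$ is a nonzero multiple of $\omega_{z,m}(t)$ whenever $t$ and $r$ are admissible. -/

import Mathlib

open Polynomial
open scoped TensorProduct

noncomputable section

/-! ### Spaces of functions -/

/-- The set of exponents of a space `V` of entire functions at the point `w`:
the orders at `w` of the nonzero elements of `V` (an identically zero germ has order `⊤`
and contributes nothing). -/
def exponents (V : Submodule ℂ (ℂ → ℂ)) (w : ℂ) : Set ℕ :=
  {e | ∃ f ∈ V, analyticOrderAt f w = (e : ℕ∞)}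

/-- The quasi-polynomial `x ↦ p(x) e^{μ x}`. -/
def quasiPoly (p : ℂ[X]) (μ : ℂ) : ℂ → ℂ := fun x => p.eval x * Complex.exp (μ * x)

/-- The space spanned by `p_i(x) e^{l_i x}`. -/
def quasiSpace {N : ℕ} (l : Fin N → ℂ) (p : Fin N → ℂ[X]) : Submodule ℂ (ℂ → ℂ) :=
  Submodule.span ℂ (Set.range fun i => quasiPoly (p i) (l i))

/-- `(V, z)` is a space of the `(l, z, n, m)`-type (a special space), for `N, M > 1`:
`V` is spanned by `p_i(x) e^{l_i x}` with `deg p_i = n_i`; the distinct points `z_a` contain all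
singular points of `V` (points whose set of exponents differs from `{0, …, N-1}`); and the set of
exponents of `V` at `z_a` is `{0, …, N-2, N-1+m_a}`. -/
structure IsSpecialSpace {N M : ℕ} (l : Fin N → ℂ) (z : Fin M → ℂ) (n : Fin N → ℕ)
    (m : Fin M → ℕ) (V : Submodule ℂ (ℂ → ℂ)) : Prop where
  one_lt_N : 1 < N
  one_lt_M : 1 < M
  l_injective : Function.Injective l
  z_injective : Function.Injective z
  exists_basis : ∃ p : Fin N → ℂ[X], (∀ i, (p i).degree = (n i : WithBot ℕ)) ∧ V = quasiSpace l p
  exponents_regular : ∀ w, w ∉ Set.range z → exponents V w = {e | e < N}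
  exponents_z : ∀ a, exponents V (z a) = {e | e < N - 1} ∪ {N - 1 + m a}

/-- The Wronskian of `f_1, …, f_k`. -/
def functionWronskian {k : ℕ} (f : Fin k → ℂ → ℂ) (x : ℂ) : ℂ :=
  (Matrix.of fun i j : Fin k => iteratedDeriv (j : ℕ) (f i) x).det

/-- The conjugate space `V^⋆` of an `N`-dimensional space `V`: the span of all
`Wr(f_1, …, f_{N-1}) / Wr_V` with `f_i ∈ V`, where `Wr_V` is the Wronskian of a basis of `V`. -/
def conjugateSpace (N : ℕ) (V : Submodule ℂ (ℂ → ℂ)) : Submodule ℂ (ℂ → ℂ) :=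
  Submodule.span ℂ {g | ∃ b : Fin N → ℂ → ℂ, LinearIndependent ℂ b ∧
    Submodule.span ℂ (Set.range b) = V ∧
    ∃ f : Fin (N - 1) → ℂ → ℂ, (∀ i, f i ∈ V) ∧ g = fun x => functionWronskian f x / functionWronskian b x}

/-- The special bispectral dual of an `N`-dimensional special space `(V, z)`: the span of all
`u ↦ ∮_{γ_a} e^{ux} f(x) ∏_b (x - z_b)⁻¹ dx`, where `f ∈ V^⋆` and `γ_a` is a small circle around
`z_a` (that is: of any sufficiently small radius `r > 0`). -/
def specialDual (N : ℕ) {M : ℕ} (z : Fin M → ℂ) (V : Submodule ℂ (ℂ → ℂ)) :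
    Submodule ℂ (ℂ → ℂ) :=
  Submodule.span ℂ {g | ∃ a : Fin M, ∃ f ∈ conjugateSpace N V,
    ∀ᶠ r : ℝ in nhdsWithin 0 (Set.Ioi 0), ∀ u : ℂ,
      g u = ∮ x in C(z a, r), Complex.exp (u * x) * f x * ∏ b, (x - z b)⁻¹}

/-- The polynomial `∑_{i=0}^k c_i (x - z_1)^{k-i}/(k-i)! (x - z_2)^i/i!`. -/
def twoPointPoly (z : Fin 2 → ℂ) (k : ℕ) (c : ℕ → ℂ) : ℂ[X] :=
  ∑ i ∈ Finset.range (k + 1),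
    C (c i / ((k - i).factorial * i.factorial)) * ((X - C (z 0)) ^ (k - i) * (X - C (z 1)) ^ i)

/-! ### Representations of `gl_2` on polynomials and the dualities -/

/-- `ℂ[x_1, x_2]`; the variable `x_1` is `X 0` and `x_2` is `X 1`. -/
abbrev Pol : Type := MvPolynomial (Fin 2) ℂ

/-- The generator `E_{ij}` of `gl_2` acting on `ℂ[x_1, x_2]` by `x_i ∂/∂x_j`. -/
def polE (i j : Fin 2) : Module.End ℂ Pol :=
  (LinearMap.mulLeft ℂ (MvPolynomial.X i : Pol)) ∘ₗ (MvPolynomial.pderiv j).toLinearMap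

/-- The irreducible `gl_2`-module `L_k` of highest weight `(k, 0)`: homogeneous polynomials of
degree `k`, with highest weight vector `v_k = x_1^k`. -/
def irrep (k : ℕ) : Submodule ℂ Pol := MvPolynomial.homogeneousSubmodule (Fin 2) ℂ k

/-- `E_{21}^j v_k / j!` in `L_k`. -/
def lowered (k j : ℕ) : Pol :=
  ((j.factorial : ℂ)⁻¹) • ((polE 1 0) ^ j) ((MvPolynomial.X 0 : Pol) ^ k)

/-- `E_{ij}` acting on the tensor product `ℂ[x_1, x_2] ⊗ ℂ[x_1, x_2]`. -/
def tensorE (i j : Fin 2) : Module.End ℂ (Pol ⊗[ℂ] Pol) :=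
  TensorProduct.map (polE i j) LinearMap.id + TensorProduct.map LinearMap.id (polE i j)

/-- The weight subspace `(L_{m_1} ⊗ L_{m_2})[n_1, n_2]`, inside `ℂ[x_1, x_2] ⊗ ℂ[x_1, x_2]`. -/
def weightSpace (m n : Fin 2 → ℕ) : Submodule ℂ (Pol ⊗[ℂ] Pol) :=
  LinearMap.range (TensorProduct.map (irrep (m 0)).subtype (irrep (m 1)).subtype) ⊓
    ⨅ i, Module.End.eigenspace (tensorE i i) (n i : ℂ)

/-- The isomorphism `ℂ[x_1, x_2]^{⊗ 2} → ℂ[x_{ai}]`,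
`p_1 ⊗ p_2 ↦ p_1(x_{11}, x_{12}) p_2(x_{21}, x_{22})`; the variable `x_{ai}` is `X (a, i)`. -/
def rowIso : (Pol ⊗[ℂ] Pol) ≃ₗ[ℂ] MvPolynomial (Fin 2 × Fin 2) ℂ :=
  ((MvPolynomial.tensorEquivSum ℂ (Fin 2) (Fin 2) ℂ).trans
    (MvPolynomial.renameEquiv ℂ ((Equiv.boolProdEquivSum (Fin 2)).symm.trans
      (Equiv.prodCongr finTwoEquiv.symm (Equiv.refl _))))).toLinearEquiv

/-- The isomorphism `ℂ[x_1, x_2]^{⊗ 2} → ℂ[x_{ai}]`,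
`p_1 ⊗ p_2 ↦ p_1(x_{11}, x_{21}) p_2(x_{12}, x_{22})`. -/
def colIso : (Pol ⊗[ℂ] Pol) ≃ₗ[ℂ] MvPolynomial (Fin 2 × Fin 2) ℂ :=
  rowIso.trans (MvPolynomial.renameEquiv ℂ (Equiv.prodComm (Fin 2) (Fin 2))).toLinearEquiv

theorem rowIso_tmul (p q : Pol) : rowIso (p ⊗ₜ[ℂ] q) =
    MvPolynomial.rename (fun i => ((0 : Fin 2), i)) p *
      MvPolynomial.rename (fun i => ((1 : Fin 2), i)) q := by
  have h : ∀ x : Pol ⊗[ℂ] Pol, rowIso x =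
      ((MvPolynomial.renameEquiv ℂ ((Equiv.boolProdEquivSum (Fin 2)).symm.trans
        (Equiv.prodCongr finTwoEquiv.symm (Equiv.refl _)))).toAlgHom.comp
        (MvPolynomial.tensorEquivSum ℂ (Fin 2) (Fin 2) ℂ).toAlgHom) x := fun _ => rfl
  have e : (MvPolynomial.renameEquiv ℂ ((Equiv.boolProdEquivSum (Fin 2)).symm.trans
        (Equiv.prodCongr finTwoEquiv.symm (Equiv.refl _)))).toAlgHom.comp
        (MvPolynomial.tensorEquivSum ℂ (Fin 2) (Fin 2) ℂ).toAlgHom =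
      Algebra.TensorProduct.lift
        (MvPolynomial.rename (fun i => ((0 : Fin 2), i)) : Pol →ₐ[ℂ] _)
        (MvPolynomial.rename (fun i => ((1 : Fin 2), i)) : Pol →ₐ[ℂ] _)
        (fun _ _ => Commute.all _ _) := by
    apply Algebra.TensorProduct.ext
    · ext i
      simp [finTwoEquiv]
    · ext i
      simp [finTwoEquiv]
  rw [h, e]
  simp

theorem colIso_tmul (p q : Pol) : colIso (p ⊗ₜ[ℂ] q) =
    MvPolynomial.rename (fun a => (a, (0 : Fin 2))) p *
      MvPolynomial.rename (fun a => (a, (1 : Fin 2))) q := by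
  simp only [colIso, LinearEquiv.trans_apply, rowIso_tmul]
  simp [MvPolynomial.rename_rename, Function.comp_def]

/-- The `(gl_2, gl_2)` duality isomorphism; it restricts to `L_n[m] ≃ L_m[n]`. -/
def dualityIso : (Pol ⊗[ℂ] Pol) ≃ₗ[ℂ] (Pol ⊗[ℂ] Pol) := colIso.trans rowIso.symm

/-- The Weyl isomorphism; it interchanges `x_1` and `x_2` in both tensor factors and restricts to
`(L_{m_1} ⊗ L_{m_2})[n_1, n_2] ≃ (L_{m_1} ⊗ L_{m_2})[n_2, n_1]`. -/
def weylIso : (Pol ⊗[ℂ] Pol) ≃ₗ[ℂ] (Pol ⊗[ℂ] Pol) :=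
  TensorProduct.congr
    (MvPolynomial.renameEquiv ℂ (Equiv.swap (0 : Fin 2) 1)).toLinearEquiv
    (MvPolynomial.renameEquiv ℂ (Equiv.swap (0 : Fin 2) 1)).toLinearEquiv

theorem lowered_eq {k j : ℕ} (h : j ≤ k) : lowered k j =
    (k.choose j : ℂ) • ((MvPolynomial.X 0 : Pol) ^ (k - j) * MvPolynomial.X 1 ^ j) := by
  have key : ∀ j ≤ k, ((polE 1 0) ^ j) ((MvPolynomial.X 0 : Pol) ^ k) =
      (k.descFactorial j : ℂ) • ((MvPolynomial.X 0 : Pol) ^ (k - j) * MvPolynomial.X 1 ^ j) := by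
    intro j
    induction j with
    | zero => intro _; simp
    | succ j ih =>
      intro hj
      obtain ⟨d, rfl⟩ : ∃ d, k = j + 1 + d := ⟨k - (j + 1), by omega⟩
      rw [pow_succ', Module.End.mul_apply, ih (by omega), map_smul]
      have h1 : j + 1 + d - j = d + 1 := by omega
      have h2 : j + 1 + d - (j + 1) = d := by omega
      rw [h1, h2, Nat.descFactorial_succ, h1]
      simp [polE, Derivation.leibniz, Derivation.leibniz_pow, MvPolynomial.smul_eq_C_mul]
      ring
  rw [lowered, key j h, smul_smul, Nat.descFactorial_eq_factorial_mul_choose]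
  congr 1
  have : (j.factorial : ℂ) ≠ 0 := Nat.cast_ne_zero.mpr j.factorial_ne_zero
  push_cast
  field_simp

/-- The defining formula of the Weyl isomorphism on the standard basis. -/
theorem weylIso_formula {m₁ m₂ k i : ℕ} (h₁ : k - i ≤ m₁) (h₂ : i ≤ m₂) (h₃ : i ≤ k) :
    weylIso (lowered m₁ (k - i) ⊗ₜ[ℂ] lowered m₂ i) =
      lowered m₁ (m₁ + i - k) ⊗ₜ[ℂ] lowered m₂ (m₂ - i) := by
  have key : ∀ {k j : ℕ}, j ≤ k →
      MvPolynomial.rename (Equiv.swap (0 : Fin 2) 1) (lowered k j) = lowered k (k - j) := by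
    intro k j h
    rw [lowered_eq h, lowered_eq (Nat.sub_le k j), Nat.choose_symm h, Nat.sub_sub_self h]
    simp [mul_comm]
  have h : m₁ + i - k = m₁ - (k - i) := by omega
  rw [h, ← key h₁, ← key h₂]
  rfl

/-- The vector `∑_i c_i E_{21}^{k-i} v_{m_1}/(k-i)! ⊗ E_{21}^i v_{m_2}/i!` in `L_{m_1} ⊗ L_{m_2}`,
the sum being over `max(0, k - m_1) ≤ i ≤ min(m_2, k)` (truncated subtraction is meant; for all
other `0 ≤ i ≤ k` one of the two tensor factors is zero). -/
def betheSum (m : Fin 2 → ℕ) (k : ℕ) (c : ℕ → ℂ) : Pol ⊗[ℂ] Pol :=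
  ∑ i ∈ Finset.Icc (k - m 0) (min (m 1) k), c i • (lowered (m 0) (k - i) ⊗ₜ[ℂ] lowered (m 1) i)

/-! ### Master functions and Bethe vectors for `N = M = 2` -/

/-- The master function `Φ(t_1, …, t_k; l; z; m)`. -/
def masterFunction (l z : Fin 2 → ℂ) (m : Fin 2 → ℕ) {k : ℕ} (t : Fin k → ℂ) : ℂ :=
  Complex.exp (l 0 * (m 0 * z 0 + m 1 * z 1) + (l 1 - l 0) * ∑ j, t j) *
    (z 0 - z 1) ^ (m 0 * m 1) *
    (∏ j, ((t j - z 0) ^ m 0)⁻¹ * ((t j - z 1) ^ m 1)⁻¹) *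
    ∏ j, ∏ j' ∈ Finset.univ.filter (fun j' => j < j'), (t j - t j') ^ 2

/-- Admissible points: distinct coordinates, none of them equal to `z_1` or `z_2`. -/
def IsAdmissible (z : Fin 2 → ℂ) {k : ℕ} (t : Fin k → ℂ) : Prop :=
  Function.Injective t ∧ ∀ j a, t j ≠ z a

/-- `t` is a critical point of the master function: all partial derivatives vanish at `t`. -/
def IsCriticalPoint (l z : Fin 2 → ℂ) (m : Fin 2 → ℕ) {k : ℕ} (t : Fin k → ℂ) : Prop :=
  ∀ j, HasDerivAt (fun s => masterFunction l z m (Function.update t j s)) 0 (t j)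

/-- The polynomial `p`, considered up to a nonzero factor, represents the orbit of `t`. -/
def Represents (p : ℂ[X]) {k : ℕ} (t : Fin k → ℂ) : Prop :=
  ∃ a : ℂ, a ≠ 0 ∧ p = C a * ∏ j, (X - C (t j))

/-- `C_i(t) = Sym ∏_{j=1}^{k-i} 1/(t_j - z_1) ∏_{j=1}^{i} 1/(t_{k-i+j} - z_2)`. -/
def betheCoeff (z : Fin 2 → ℂ) {k : ℕ} (t : Fin k → ℂ) (i : ℕ) : ℂ :=
  ∑ σ : Equiv.Perm (Fin k), ∏ j : Fin k,
    if (j : ℕ) < k - i then (t (σ j) - z 0)⁻¹ else (t (σ j) - z 1)⁻¹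

/-- The universal rational function `ω(t)`, with values in `L_{m_1} ⊗ L_{m_2}`. -/
def universalVector (z : Fin 2 → ℂ) (m : Fin 2 → ℕ) {k : ℕ} (t : Fin k → ℂ) : Pol ⊗[ℂ] Pol :=
  betheSum m k (betheCoeff z t)

/-- The pair `(a_2, a_1)`. -/
def swapPair {α : Type} (a : Fin 2 → α) : Fin 2 → α := a ∘ Equiv.swap 0 1

end

/-! Everything reduces to one three-term recurrence. At `z a` the exponent `1 + m a` forces `(x - z
a) ^ m a` to divide the polynomial part of the Wronskian of `V`. Its degree is `n 0 + n 1 = m 0 + m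
1`, so it is a constant multiple of `(x - z 0) ^ m 0 * (x - z 1) ^ m 1`. Differentiating this and
using coprimality of `p 0` and `p 1` gives confluent Heun equations for both, with accessory
parameters determined by a single number `E` (`exists_solvesHeun`).

The integrals defining the dual space satisfy the bispectral dual equation, because the dual
operator turns the integrand into an exact derivative. Hence `q 1` solves the Heun equation with
`(l, n)` and `(z, m)` interchanged and the same `E` (`solvesDual_of_mem_specialDual`,
`solvesHeun_of_solvesDual`).

In a two-point basis the Heun equation becomes the recurrence `heunRec`. It is unchanged by the
duality (`heunRec_dual`), and reversal of indices, which is what the Weyl map does, exchanges the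
equations of `p 0` and `p 1` (`heunRec_reverse`). So `c`, the reversed `d`, and `e` satisfy one
recurrence. On the block of indices occurring in `betheSum` it decouples from the indices below, and
a solution there is fixed by its first entry; this gives the common line. A solution not vanishing
at the singular points cannot vanish on the whole block (`SolvesHeun.exists_coeff_ne_zero`).

For the Bethe vectors, the Heun equation at a root is the critical point equation, and symmetrizing
the expansion of `∏ (x - t j)` identifies the coefficients of the universal vector with those of the
polynomial, up to the signs `(-1) ^ i` (`betheCoeff_eq`). -/

/-! ### The confluent Heun operator -/

/-- The operator `p ↦ (x - y₁)(x - y₂)(p'' + δ p') - (M₁ (x - y₂) + M₂ (x - y₁)) p'`. -/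
noncomputable def heunOp (y : Fin 2 → ℂ) (M : Fin 2 → ℕ) (δ : ℂ) : ℂ[X] →ₗ[ℂ] ℂ[X] :=
  LinearMap.mulLeft ℂ ((X - C (y 0)) * (X - C (y 1))) ∘ₗ
      (derivative ∘ₗ derivative + δ • derivative) -
    LinearMap.mulLeft ℂ (C (M 0 : ℂ) * (X - C (y 1)) + C (M 1 : ℂ) * (X - C (y 0))) ∘ₗ derivative

theorem heunOp_apply (y : Fin 2 → ℂ) (M : Fin 2 → ℕ) (δ : ℂ) (p : ℂ[X]) :
    heunOp y M δ p = (X - C (y 0)) * (X - C (y 1)) *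
      (derivative (derivative p) + C δ * derivative p) -
      (C (M 0 : ℂ) * (X - C (y 1)) + C (M 1 : ℂ) * (X - C (y 0))) * derivative p := by
  simp [heunOp, smul_eq_C_mul, mul_assoc]

/-- Polynomial solutions, of expected degree `k`, of the confluent Heun equation with accessory
parameter `E`. -/
def SolvesHeun (y : Fin 2 → ℂ) (M : Fin 2 → ℕ) (δ : ℂ) (k : ℕ) (E : ℂ) (p : ℂ[X]) : Prop :=
  heunOp y M δ p = (C (δ * k) * (X - C (y 1)) + C E) * p

/-- The shift by two avoids truncated subtraction; degrees from two up suffice to control the top of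
the image. -/
theorem coeff_heunOp_add_two (y : Fin 2 → ℂ) (M : Fin 2 → ℕ) (δ : ℂ) (p : ℂ[X]) (j : ℕ) :
    (heunOp y M δ p).coeff (j + 2) = δ * (j + 1) * p.coeff (j + 1) +
      ((j + 1) - δ * (y 0 + y 1) - M 0 - M 1) * (j + 2) * p.coeff (j + 2) +
      (δ * y 0 * y 1 - (y 0 + y 1) * (j + 2) + M 0 * y 1 + M 1 * y 0) * (j + 3) *
        p.coeff (j + 3) + y 0 * y 1 * (j + 3) * (j + 4) * p.coeff (j + 4) := by
  have h : heunOp y M δ p = C δ * (X * (X * derivative p)) +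
      X * (X * derivative (derivative p)) - C (y 0 + y 1) * (X * derivative (derivative p)) +
      C (y 0 * y 1) * derivative (derivative p) +
      C (-δ * (y 0 + y 1) - M 0 - M 1) * (X * derivative p) +
      C (δ * y 0 * y 1 + M 0 * y 1 + M 1 * y 0) * derivative p := by
    rw [heunOp_apply]
    simp only [map_add, map_mul, map_sub, map_neg]
    ring
  rw [h]
  simp only [coeff_add, coeff_sub, coeff_C_mul, coeff_X_mul, coeff_derivative]
  push_cast
  ring

/-- Only `δ x² p'` raises the degree, so it alone contributes in degree `k + 1`. -/
theorem coeff_heunOp_top {y : Fin 2 → ℂ} {M : Fin 2 → ℕ} {δ : ℂ} {p : ℂ[X]} {k : ℕ}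
    (hp : p.natDegree ≤ k) : (heunOp y M δ p).coeff (k + 1) = δ * k * p.coeff k := by
  have hz : ∀ j, k < j → p.coeff j = 0 := fun j hj => coeff_eq_zero_of_natDegree_lt (by omega)
  cases k with
  | zero =>
    rw [eq_C_of_natDegree_le_zero hp, heunOp_apply]
    simp
  | succ j =>
    rw [coeff_heunOp_add_two, hz (j + 2) (by omega), hz (j + 3) (by omega), hz (j + 4) (by omega)]
    push_cast
    ring

theorem natDegree_heunOp_le {y : Fin 2 → ℂ} {M : Fin 2 → ℕ} {δ : ℂ} {p : ℂ[X]} {k : ℕ}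
    (hp : p.natDegree ≤ k) : (heunOp y M δ p).natDegree ≤ k + 1 := by
  have hz : ∀ j, k < j → p.coeff j = 0 := fun j hj => coeff_eq_zero_of_natDegree_lt (by omega)
  rw [natDegree_le_iff_coeff_eq_zero]
  intro N hN
  obtain ⟨j, rfl⟩ : ∃ j, N = j + 2 := ⟨N - 2, by omega⟩
  rw [coeff_heunOp_add_two, hz (j + 1) (by omega), hz (j + 2) (by omega), hz (j + 3) (by omega),
    hz (j + 4) (by omega)]
  ring

/-- A nonzero solution of degree `d` satisfies `δ d = δ k` by comparing coefficients in degree `d +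
1`, so `d = k`. Hence solutions of degree at most `k` are determined by their coefficient of `x ^
k`. -/
theorem SolvesHeun.eq_zero {y : Fin 2 → ℂ} {M : Fin 2 → ℕ} {δ E : ℂ} {k : ℕ} {p : ℂ[X]}
    (h : SolvesHeun y M δ k E p) (hδ : δ ≠ 0) (hp : p.natDegree ≤ k) (hk : p.coeff k = 0) :
    p = 0 := by
  by_contra hne
  have hlc : p.coeff p.natDegree ≠ 0 := by simpa using hne
  have hlt : p.natDegree < k := lt_of_le_of_ne hp (fun e => hlc (e ▸ hk))
  have h1 := congrArg (fun q => coeff q (p.natDegree + 1)) h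
  have h2 : (C (δ * k) * (X - C (y 1)) + C E) * p =
      C (δ * k) * (X * p) + C (E - δ * k * y 1) * p := by
    simp only [map_sub, map_mul]; ring
  simp only [coeff_heunOp_top le_rfl, h2, coeff_add, coeff_C_mul, coeff_X_mul] at h1
  rw [coeff_eq_zero_of_natDegree_lt (Nat.lt_succ_self _)] at h1
  have h3 : δ * p.coeff p.natDegree * ((k : ℂ) - p.natDegree) = 0 := by linear_combination -h1
  have h4 : (k : ℂ) - p.natDegree ≠ 0 := sub_ne_zero.2 (by exact_mod_cast hlt.ne')
  simp_all

theorem SolvesHeun.smul_sub_smul {y : Fin 2 → ℂ} {M : Fin 2 → ℕ} {δ E : ℂ} {k : ℕ} {p r : ℂ[X]}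
    (hp : SolvesHeun y M δ k E p) (hr : SolvesHeun y M δ k E r) (a b : ℂ) :
    SolvesHeun y M δ k E (a • p - b • r) := by
  unfold SolvesHeun at *
  rw [map_sub, map_smul, map_smul, hp, hr]
  simp only [smul_eq_C_mul]
  ring

/-! ### Expansions at two points -/

/-- The truncated exponent `i - 1` is harmless: at `i = 0` its term carries the factor `0`. -/
theorem X_sub_C_mul_derivative (a b : ℂ) (s i : ℕ) :
    (X - C a) * derivative ((X - C a) ^ s * (X - C b) ^ i : ℂ[X]) =
      C (s : ℂ) * ((X - C a) ^ s * (X - C b) ^ i) +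
        C (i : ℂ) * ((X - C a) ^ (s + 1) * (X - C b) ^ (i - 1)) := by
  simp only [derivative_mul, derivative_X_sub_C_pow]
  cases s with
  | zero => simp; ring
  | succ s => simp; ring

theorem X_sub_C_mul_derivative' (a b : ℂ) (s i : ℕ) :
    (X - C b) * derivative ((X - C a) ^ s * (X - C b) ^ i : ℂ[X]) =
      C (i : ℂ) * ((X - C a) ^ s * (X - C b) ^ i) +
        C (s : ℂ) * ((X - C a) ^ (s - 1) * (X - C b) ^ (i + 1)) := by
  have := X_sub_C_mul_derivative b a i s
  rw [mul_comm ((X - C a) ^ s), mul_comm ((X - C a) ^ (s - 1)), this]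

theorem twoPointPoly_add (y : Fin 2 → ℂ) (k : ℕ) (c c' : ℕ → ℂ) :
    twoPointPoly y k (fun i => c i + c' i) = twoPointPoly y k c + twoPointPoly y k c' := by
  simp only [twoPointPoly, ← Finset.sum_add_distrib, ← add_mul, ← C_add, add_div]

theorem C_mul_twoPointPoly (y : Fin 2 → ℂ) (k : ℕ) (a : ℂ) (c : ℕ → ℂ) :
    C a * twoPointPoly y k c = twoPointPoly y k (fun i => a * c i) := by
  simp only [twoPointPoly, Finset.mul_sum, ← mul_assoc, ← C_mul, mul_div_assoc]

theorem twoPointPoly_sub (y : Fin 2 → ℂ) (k : ℕ) (c c' : ℕ → ℂ) :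
    twoPointPoly y k (fun i => c i - c' i) = twoPointPoly y k c - twoPointPoly y k c' := by
  simp only [twoPointPoly, ← Finset.sum_sub_distrib, ← sub_mul, ← C_sub, sub_div]

theorem twoPointPoly_congr {y : Fin 2 → ℂ} {k : ℕ} {c c' : ℕ → ℂ} (h : ∀ i ≤ k, c i = c' i) :
    twoPointPoly y k c = twoPointPoly y k c' :=
  Finset.sum_congr rfl fun i hi => by rw [h i (Finset.mem_range_succ_iff.1 hi)]

/-- With the factorial normalization, `(x - y 0) d/dx` maps the `i`-th basis element `b_i` to `(k -
i) b_i + (k - i + 1) b_{i-1}`. The out-of-range value `c (k + 1)` appears only with factor zero. -/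
theorem X_sub_C_mul_derivative_twoPointPoly (y : Fin 2 → ℂ) (k : ℕ) (c : ℕ → ℂ) :
    (X - C (y 0)) * derivative (twoPointPoly y k c) =
      twoPointPoly y k (fun i => (k - i) * (c i + c (i + 1))) := by
  have h1 : (X - C (y 0)) * derivative (twoPointPoly y k c) =
      twoPointPoly y k (fun i => (k - i) * c i) + ∑ i ∈ Finset.range (k + 1),
        C (i * c i / ((k - i).factorial * i.factorial)) *
          ((X - C (y 0)) ^ (k - i + 1) * (X - C (y 1)) ^ (i - 1)) := by
    simp only [twoPointPoly, derivative_sum, Finset.mul_sum, derivative_C_mul,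
      ← Finset.sum_add_distrib]
    refine Finset.sum_congr rfl fun i hi => ?_
    have hi := Finset.mem_range_succ_iff.1 hi
    rw [mul_left_comm, X_sub_C_mul_derivative, Nat.cast_sub hi]
    simp only [mul_add, ← mul_assoc, ← C_mul]
    congr! 4 <;> ring
  simp only [mul_add]
  rw [h1, twoPointPoly_add]
  congr 1
  rw [Finset.sum_range_succ', twoPointPoly, Finset.sum_range_succ]
  simp only [Nat.cast_zero, zero_mul, zero_div, map_zero, add_zero, sub_self]
  refine Finset.sum_congr rfl fun i hi => ?_
  have hi := Finset.mem_range.1 hi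
  obtain ⟨d, rfl⟩ : ∃ d, k = i + d + 1 := ⟨k - i - 1, by omega⟩
  have e1 : i + d + 1 - (i + 1) = d := by omega
  have e2 : i + d + 1 - i = d + 1 := by omega
  rw [e1, e2, Nat.factorial_succ, Nat.factorial_succ, Nat.add_sub_cancel]
  congr 2
  have f1 : (i.factorial : ℂ) ≠ 0 := by exact_mod_cast i.factorial_ne_zero
  have f2 : (d.factorial : ℂ) ≠ 0 := by exact_mod_cast d.factorial_ne_zero
  have f3 : (i : ℂ) + 1 ≠ 0 := by exact_mod_cast i.succ_ne_zero
  have f4 : (d : ℂ) + 1 ≠ 0 := by exact_mod_cast d.succ_ne_zero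
  push_cast
  field_simp
  ring

theorem X_sub_C_mul_derivative_twoPointPoly' (y : Fin 2 → ℂ) (k : ℕ) (c : ℕ → ℂ) :
    (X - C (y 1)) * derivative (twoPointPoly y k c) =
      twoPointPoly y k (fun i => i * (c i + c (i - 1))) := by
  have h1 : (X - C (y 1)) * derivative (twoPointPoly y k c) =
      twoPointPoly y k (fun i => i * c i) + ∑ i ∈ Finset.range (k + 1),
        C ((k - i) * c i / ((k - i).factorial * i.factorial)) *
          ((X - C (y 0)) ^ (k - i - 1) * (X - C (y 1)) ^ (i + 1)) := by
    simp only [twoPointPoly, derivative_sum, Finset.mul_sum, derivative_C_mul,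
      ← Finset.sum_add_distrib]
    refine Finset.sum_congr rfl fun i hi => ?_
    have hi := Finset.mem_range_succ_iff.1 hi
    rw [mul_left_comm, X_sub_C_mul_derivative', Nat.cast_sub hi]
    simp only [mul_add, ← mul_assoc, ← C_mul]
    congr! 4 <;> ring
  simp only [mul_add]
  rw [h1, twoPointPoly_add]
  congr 1
  rw [Finset.sum_range_succ, twoPointPoly, Finset.sum_range_succ']
  simp only [Nat.cast_zero, zero_mul, zero_div, map_zero, add_zero, sub_self]
  refine Finset.sum_congr rfl fun i hi => ?_
  have hi := Finset.mem_range.1 hi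
  obtain ⟨d, rfl⟩ : ∃ d, k = i + d + 1 := ⟨k - i - 1, by omega⟩
  have e1 : i + d + 1 - (i + 1) = d := by omega
  have e2 : i + d + 1 - i = d + 1 := by omega
  rw [e1, e2, Nat.factorial_succ, Nat.factorial_succ, Nat.add_sub_cancel, Nat.add_sub_cancel]
  congr 2
  have f1 : (i.factorial : ℂ) ≠ 0 := by exact_mod_cast i.factorial_ne_zero
  have f2 : (d.factorial : ℂ) ≠ 0 := by exact_mod_cast d.factorial_ne_zero
  have f3 : (i : ℂ) + 1 ≠ 0 := by exact_mod_cast i.succ_ne_zero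
  have f4 : (d : ℂ) + 1 ≠ 0 := by exact_mod_cast d.succ_ne_zero
  push_cast
  field_simp
  ring

/-- Subtracting `k p` cancels the growth in degree, and what remains is diagonal in the two-point
basis. This is why the eigenvalue term in `SolvesHeun` is centred at `y 1`. -/
theorem mul_derivative_sub_twoPointPoly (y : Fin 2 → ℂ) (k : ℕ) (c : ℕ → ℂ) :
    (X - C (y 1)) * ((X - C (y 0)) * derivative (twoPointPoly y k c) -
      C (k : ℂ) * twoPointPoly y k c) = twoPointPoly y k (fun i => (y 1 - y 0) * (i * c i)) := by
  rw [← C_mul_twoPointPoly]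
  simp only [twoPointPoly, derivative_sum, Finset.mul_sum, derivative_C_mul,
    ← Finset.sum_sub_distrib]
  refine Finset.sum_congr rfl fun i hi => ?_
  have hi := Finset.mem_range_succ_iff.1 hi
  rw [mul_left_comm (X - C (y 0)), X_sub_C_mul_derivative, Nat.cast_sub hi]
  have e : C (i * c i / ((k - i).factorial * i.factorial)) =
    C (i : ℂ) * C (c i / ((k - i).factorial * i.factorial)) := by rw [← C_mul, mul_div_assoc]
  rw [e]
  generalize c i / ((k - i).factorial * i.factorial) = a
  cases i with
  | zero => simp; right; ring
  | succ i =>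
    simp only [map_sub, Nat.add_sub_cancel, pow_succ]
    ring

/-- The three-term recurrence operator of the confluent Heun equation in a two-point expansion. -/
noncomputable def heunRec (M : Fin 2 → ℕ) (ε : ℂ) (k : ℕ) (E : ℂ) (c : ℕ → ℂ) (i : ℕ) : ℂ :=
  i * (k - i - M 0) * c (i - 1) +
    (2 * i * (k - i) - M 0 * i - M 1 * (k - i) + ε * i - E) * c i + (k - i) * (i - M 1) * c (i + 1)

theorem heunOp_twoPointPoly (y : Fin 2 → ℂ) (M : Fin 2 → ℕ) (δ : ℂ) (k : ℕ) (E : ℂ)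
    (c : ℕ → ℂ) :
    heunOp y M δ (twoPointPoly y k c) -
        (C (δ * k) * (X - C (y 1)) + C E) * twoPointPoly y k c =
      twoPointPoly y k (heunRec M (δ * (y 1 - y 0)) k E c) := by
  have hb := X_sub_C_mul_derivative_twoPointPoly' y k c
  have ha := X_sub_C_mul_derivative_twoPointPoly y k c
  -- Uses `(x - y 0)(x - y 1) p'' = (x - y 1) ((x - y 0) p')' - (x - y 1) p'`.
  have hab : (X - C (y 0)) * (X - C (y 1)) * derivative (derivative (twoPointPoly y k c)) =
      twoPointPoly y k (fun i => i * ((k - i) * (c i + c (i + 1)) +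
        (k - (i - 1 : ℕ)) * (c (i - 1) + c (i - 1 + 1)))) -
      twoPointPoly y k (fun i => i * (c i + c (i - 1))) := by
    rw [← X_sub_C_mul_derivative_twoPointPoly' y k (fun i => (k - i) * (c i + c (i + 1))), ← hb,
      ← ha, derivative_mul]
    simp
    ring
  have hd := mul_derivative_sub_twoPointPoly y k c
  -- The term `δ k (x - y 1) p` is paired with the `δ` part of the operator, so that every summand
  -- stays in the span of the basis of degree `k`.
  have key : heunOp y M δ (twoPointPoly y k c) -
        (C (δ * k) * (X - C (y 1)) + C E) * twoPointPoly y k c =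
      (X - C (y 0)) * (X - C (y 1)) * derivative (derivative (twoPointPoly y k c)) +
      C δ * ((X - C (y 1)) * ((X - C (y 0)) * derivative (twoPointPoly y k c) -
        C (k : ℂ) * twoPointPoly y k c)) -
      C (M 0 : ℂ) * ((X - C (y 1)) * derivative (twoPointPoly y k c)) -
      C (M 1 : ℂ) * ((X - C (y 0)) * derivative (twoPointPoly y k c)) -
      C E * twoPointPoly y k c := by
    rw [heunOp_apply]
    simp only [map_mul]
    ring
  rw [key, hab, hd, ha, hb]
  simp only [C_mul_twoPointPoly, ← twoPointPoly_sub, ← twoPointPoly_add]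
  refine twoPointPoly_congr fun i _ => ?_
  unfold heunRec
  cases i with
  | zero => simp; ring
  | succ i => push_cast [Nat.add_sub_cancel]; ring

/-- Evaluation at `b` isolates the coefficient `g 0`; then a factor `X - C b` can be cancelled,
which lowers `k`. -/
theorem sum_X_sub_C_pow_mul_eq_zero {a b : ℂ} (hab : a ≠ b) : ∀ (k : ℕ) (g : ℕ → ℂ),
    ∑ i ∈ Finset.range (k + 1), C (g i) * ((X - C a) ^ (k - i) * (X - C b) ^ i) = 0 →
    ∀ i ≤ k, g i = 0 := by
  intro k
  induction k with
  | zero =>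
    intro g h i hi
    obtain rfl : i = 0 := by omega
    simpa using h
  | succ k ih =>
    intro g h
    rw [Finset.sum_range_succ'] at h
    have h0 : g 0 = 0 := by
      have := congrArg (eval b) h
      simpa [eval_finsetSum, sub_ne_zero.2 hab.symm] using this
    have h' : (X - C b) * ∑ i ∈ Finset.range (k + 1),
        C (g (i + 1)) * ((X - C a) ^ (k - i) * (X - C b) ^ i) = 0 := by
      rw [← h, h0, Finset.mul_sum]
      simp only [map_zero, zero_mul, add_zero]
      refine Finset.sum_congr rfl fun i _ => ?_
      rw [Nat.add_sub_add_right]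
      ring
    have h2 := ih (fun i => g (i + 1)) ((mul_eq_zero.1 h').resolve_left (X_sub_C_ne_zero b))
    intro i hi
    cases i with
    | zero => exact h0
    | succ i => exact h2 i (by omega)

theorem twoPointPoly_eq_zero {y : Fin 2 → ℂ} (hy : y 0 ≠ y 1) {k : ℕ} {c : ℕ → ℂ}
    (h : twoPointPoly y k c = 0) : ∀ i ≤ k, c i = 0 := fun i hi => by
  have := sum_X_sub_C_pow_mul_eq_zero hy k _ h i hi
  simpa [Nat.factorial_ne_zero] using this

theorem solvesHeun_twoPointPoly_iff {y : Fin 2 → ℂ} (hy : y 0 ≠ y 1) {M : Fin 2 → ℕ} {δ E : ℂ}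
    {k : ℕ} {c : ℕ → ℂ} : SolvesHeun y M δ k E (twoPointPoly y k c) ↔
      ∀ i ≤ k, heunRec M (δ * (y 1 - y 0)) k E c i = 0 := by
  unfold SolvesHeun
  rw [← sub_eq_zero, heunOp_twoPointPoly]
  refine ⟨fun h => twoPointPoly_eq_zero hy h, fun h => ?_⟩
  rw [twoPointPoly_congr (c' := fun _ => 0) h]
  simp [twoPointPoly]

theorem natDegree_twoPointPoly_le (y : Fin 2 → ℂ) (k : ℕ) (c : ℕ → ℂ) :
    (twoPointPoly y k c).natDegree ≤ k := by
  refine natDegree_sum_le_of_forall_le _ _ fun i hi => ?_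
  have hi := Finset.mem_range_succ_iff.1 hi
  refine (natDegree_C_mul_le _ _).trans (natDegree_mul_le.trans ?_)
  simp only [natDegree_pow, natDegree_X_sub_C]
  omega

theorem eval_zero_twoPointPoly (y : Fin 2 → ℂ) (k : ℕ) (c : ℕ → ℂ) :
    (twoPointPoly y k c).eval (y 0) = c k / k.factorial * (y 0 - y 1) ^ k := by
  rw [twoPointPoly, eval_finsetSum, Finset.sum_eq_single_of_mem k (by simp)]
  · simp
  · intro i hi hik
    have : k - i ≠ 0 := by have := Finset.mem_range_succ_iff.1 hi; omega
    simp [this]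

theorem eval_one_twoPointPoly (y : Fin 2 → ℂ) (k : ℕ) (c : ℕ → ℂ) :
    (twoPointPoly y k c).eval (y 1) = c 0 / k.factorial * (y 1 - y 0) ^ k := by
  rw [twoPointPoly, eval_finsetSum, Finset.sum_eq_single_of_mem 0 (by simp)]
  · simp
  · intro i hi hik
    simp [hik]

/-- If a polynomial solution does not vanish at the two singular points, then one of its
coefficients in the central block of the recurrence is nonzero. -/
theorem SolvesHeun.exists_coeff_ne_zero {y : Fin 2 → ℂ} (hy : y 0 ≠ y 1) {M : Fin 2 → ℕ}
    {δ E : ℂ} {k : ℕ} {c : ℕ → ℂ} (h : SolvesHeun y M δ k E (twoPointPoly y k c)) (hδ : δ ≠ 0)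
    (hkM : k ≤ M 0 + M 1) (hdeg : (twoPointPoly y k c).degree = k) (hne : ∀ a, (twoPointPoly y k c).eval (y a) ≠ 0) :
    ∃ i ∈ Finset.Icc (k - M 0) (min (M 1) k), c i ≠ 0 := by
  by_contra! hc
  simp only [Finset.mem_Icc] at hc
  have h0 : c 0 ≠ 0 := fun e => hne 1 (by rw [eval_one_twoPointPoly, e]; simp)
  have hk : c k ≠ 0 := fun e => hne 0 (by rw [eval_zero_twoPointPoly, e]; simp)
  -- A block reaching either end of `0, …, k` would contain `c 0` or `c k`, which are nonzero
  -- multiples of the values at `y 1` and `y 0`.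
  have hlo : 0 < k - M 0 := by
    by_contra hh
    exact h0 (hc 0 ⟨by omega, by omega⟩)
  have hhi : M 1 < k := by
    by_contra hh
    exact hk (hc k ⟨by omega, by omega⟩)
  set i₀ := k - M 0 with hi₀
  have hcent : ∀ i, i₀ ≤ i → i ≤ M 1 → c i = 0 := fun i h1 h2 => hc i ⟨h1, by omega⟩
  rw [solvesHeun_twoPointPoly_iff hy] at h
  -- The part of `c` below the block is itself a solution: `c` vanishes at `i₀`, and the recurrence
  -- at `i₀` multiplies `c (i₀ - 1)` by `k - i₀ - M 0 = 0`.
  set c' : ℕ → ℂ := fun i => if i < i₀ then c i else 0 with hc'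
  have hsol : SolvesHeun y M δ k E (twoPointPoly y k c') := by
    rw [solvesHeun_twoPointPoly_iff hy]
    intro i hi
    rcases lt_or_ge i i₀ with hlt | hge
    · rw [← h i hi]
      have e1 : c' (i + 1) = c (i + 1) := by
        simp only [hc']
        split_ifs with h1
        · rfl
        · exact (hcent (i + 1) (by omega) (by omega)).symm
      have e2 : c' i = c i := by simp [hc', hlt]
      have e3 : c' (i - 1) = c (i - 1) := by simp [hc', show i - 1 < i₀ by omega]
      simp only [heunRec, e1, e2, e3]
    · have e1 : c' (i + 1) = 0 := by simp [hc', show ¬ i + 1 < i₀ by omega]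
      have e2 : c' i = 0 := by simp [hc', show ¬ i < i₀ by omega]
      rcases eq_or_lt_of_le hge with rfl | hlt
      · have : ((i₀ : ℕ) : ℂ) = k - M 0 := by rw [hi₀, Nat.cast_sub (by omega)]
        simp only [heunRec, e1, e2, this]
        ring
      · have e3 : c' (i - 1) = 0 := by simp [hc', show ¬ i - 1 < i₀ by omega]
        simp [heunRec, e1, e2, e3]
  set p := twoPointPoly y k c with hp
  set r := twoPointPoly y k c' with hr
  have hpk : p.coeff k ≠ 0 := by
    have := coeff_ne_zero_of_eq_degree hdeg
    exact this
  -- This combination of the two solutions has no `x ^ k` term, so it vanishes. As `r` is zero at `y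
  -- 0` and `p` is not, `r` must be zero, contradicting `c 0 ≠ 0`.
  have hlin := ((((solvesHeun_twoPointPoly_iff hy).2 h).smul_sub_smul hsol (r.coeff k)
    (p.coeff k))).eq_zero hδ
    ((natDegree_sub_le _ _).trans (max_le ((natDegree_smul_le _ _).trans
      (natDegree_twoPointPoly_le _ _ _)) ((natDegree_smul_le _ _).trans
      (natDegree_twoPointPoly_le _ _ _)))) (by simp [← hp, mul_comm])
  have hr0 : r.eval (y 0) = 0 := by
    rw [hr, eval_zero_twoPointPoly]
    simp [hc', show ¬ k < i₀ by omega]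
  have h1 := congrArg (eval (y 0)) hlin
  rw [eval_sub, eval_smul, eval_smul, hr0] at h1
  have h2 : r.coeff k = 0 := by simpa [← hp, hne 0] using h1
  have h3 : r = 0 := by simpa [h2, hpk] using hlin
  have := twoPointPoly_eq_zero hy h3 0 (Nat.zero_le _)
  simp [hc', hlo, h0] at this

/-! ### Critical points of the master function -/

theorem prod_update {α : Type*} {ι : Type*} [Fintype ι] [DecidableEq ι] (t : ι → α) (j : ι) (s : α)
    (f : α → ℂ) : ∏ i, f (Function.update t j s i) = f s * ∏ i ∈ Finset.univ.erase j, f (t i) := by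
  rw [← Finset.mul_prod_erase _ _ (Finset.mem_univ j), Function.update_self]
  congr 1
  exact Finset.prod_congr rfl fun i hi => by rw [Function.update_of_ne (Finset.ne_of_mem_erase hi)]

/-- The dependence on the single coordinate `t j`: pairs without `j` go into the constant, and the
squares make the order within a pair irrelevant. -/
theorem prod_prod_update {k : ℕ} (t : Fin k → ℂ) (j : Fin k) : ∃ c : ℂ, ∀ s,
    ∏ i, ∏ i' ∈ Finset.univ.filter (fun i' => i < i'),
      (Function.update t j s i - Function.update t j s i') ^ 2 =
    c * (∏ i ∈ Finset.univ.erase j, (s - t i)) ^ 2 := by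
  refine ⟨∏ i, ∏ i' ∈ Finset.univ.filter (fun i' => i < i'),
      if i = j ∨ i' = j then 1 else (t i - t i') ^ 2, fun s => ?_⟩
  have h : ∀ i, ∀ i' ∈ Finset.univ.filter (fun i' => i < i'),
      (Function.update t j s i - Function.update t j s i') ^ 2 =
      (if i = j ∨ i' = j then 1 else (t i - t i') ^ 2) *
        ((if i = j then (s - t i') ^ 2 else 1) * (if i' = j then (s - t i) ^ 2 else 1)) := by
    intro i i' hi
    have hlt : i < i' := by simpa using hi
    rcases eq_or_ne i j with rfl | h1
    · simp [hlt.ne']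
    · rcases eq_or_ne i' j with rfl | h2
      · simp only [h1, Function.update_self, ne_eq, not_false_eq_true, Function.update_of_ne]
        simp
        ring
      · simp [h1, h2]
  rw [Finset.prod_congr rfl fun i _ => Finset.prod_congr rfl (h i)]
  simp only [Finset.prod_mul_distrib]
  congr 1
  have h1 : ∏ i, ∏ i' ∈ Finset.univ.filter (fun i' => i < i'),
      (if i = j then (s - t i') ^ 2 else 1) =
      ∏ i' ∈ Finset.univ.filter (fun i' => j < i'), (s - t i') ^ 2 := by
    rw [Finset.prod_eq_single j]
    · simp
    · intro b _ hb; simp [hb]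
    · simp
  have h2 : ∏ i, ∏ i' ∈ Finset.univ.filter (fun i' => i < i'),
      (if i' = j then (s - t i) ^ 2 else 1) =
      ∏ i ∈ Finset.univ.filter (fun i => i < j), (s - t i) ^ 2 := by
    rw [Finset.prod_filter]
    refine Finset.prod_congr rfl fun i _ => ?_
    rw [Finset.prod_ite_eq']
    simp
  rw [h1, h2, ← Finset.prod_pow, ← Finset.prod_union]
  · refine Finset.prod_congr ?_ fun _ _ => rfl
    ext i
    simpa [lt_or_lt_iff_ne] using not_congr eq_comm
  · rw [Finset.disjoint_left]
    intro i
    simp only [Finset.mem_filter, Finset.mem_univ, true_and]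
    exact fun h1 h2 => absurd h1 h2.not_gt

/-- Write `p = a (x - t j) Q`. At `t j` the accessory term drops out and the equation reads `2 Q' +
δ Q = (M 0 / (x - y 0) + M 1 / (x - y 1)) Q`. As a function of `s = t j` the master function is a
constant times `exp (δ s) (s - y 0)^(-M 0) (s - y 1)^(-M 1) Q(s)²`, so this equation makes its
derivative vanish. -/
theorem isCriticalPoint_of_solvesHeun {l y : Fin 2 → ℂ} {M : Fin 2 → ℕ} {E : ℂ} {k : ℕ}
    {p : ℂ[X]} {t : Fin k → ℂ} (h : SolvesHeun y M (l 1 - l 0) k E p) (hp : Represents p t)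
    (ht : IsAdmissible y t) : IsCriticalPoint l y M t := by
  intro j
  obtain ⟨a, ha, hpa⟩ := hp
  obtain ⟨c, hc⟩ := prod_prod_update t j
  set Q : ℂ[X] := ∏ i ∈ Finset.univ.erase j, (X - C (t i)) with hQ
  have hQev : ∀ s, ∏ i ∈ Finset.univ.erase j, (s - t i) = Q.eval s := by
    intro s; simp [hQ, eval_prod]
  have hpQ : p = C a * ((X - C (t j)) * Q) := by
    rw [hpa, hQ, Finset.mul_prod_erase _ (fun i => X - C (t i)) (Finset.mem_univ j)]
  have h0 : t j - y 0 ≠ 0 := sub_ne_zero.2 (ht.2 j 0)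
  have h1 : t j - y 1 ≠ 0 := sub_ne_zero.2 (ht.2 j 1)
  set δ := l 1 - l 0 with hδ
  have hode : (t j - y 0) * (t j - y 1) * (2 * (derivative Q).eval (t j) + δ * Q.eval (t j)) =
      (M 0 * (t j - y 1) + M 1 * (t j - y 0)) * Q.eval (t j) := by
    unfold SolvesHeun at h
    have := congrArg (eval (t j)) h
    rw [heunOp_apply, hpQ] at this
    simp only [derivative_mul, derivative_sub, derivative_X, derivative_C, derivative_add, eval_add,
      eval_mul, eval_sub, eval_X, eval_C, derivative_one, eval_one, derivative_zero] at this
    simp only [sub_self, zero_mul, sub_zero, one_mul, zero_add, mul_zero, add_zero, eval_zero]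
      at this
    have h2 : a * ((t j - y 0) * (t j - y 1) *
      (2 * (derivative Q).eval (t j) + δ * Q.eval (t j)) -
      (M 0 * (t j - y 1) + M 1 * (t j - y 0)) * Q.eval (t j)) = 0 := by
      linear_combination this
    exact sub_eq_zero.1 ((mul_eq_zero.1 h2).resolve_left ha)
  obtain ⟨K, hK⟩ : ∃ K : ℂ, ∀ s, masterFunction l y M (Function.update t j s) =
      K * (Complex.exp (δ * s) * (((s - y 0) ^ M 0)⁻¹ * ((s - y 1) ^ M 1)⁻¹) *
        Q.eval s ^ 2) := by
    refine ⟨Complex.exp (l 0 * (M 0 * y 0 + M 1 * y 1) +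
      δ * ∑ i ∈ Finset.univ.erase j, t i) * (y 0 - y 1) ^ (M 0 * M 1) *
      (∏ i ∈ Finset.univ.erase j, ((t i - y 0) ^ M 0)⁻¹ * ((t i - y 1) ^ M 1)⁻¹) * c, fun s => ?_⟩
    have hs : ∑ i, Function.update t j s i = s + ∑ i ∈ Finset.univ.erase j, t i := by
      rw [← Finset.add_sum_erase _ _ (Finset.mem_univ j), Function.update_self]
      congr 1
      exact Finset.sum_congr rfl fun i hi => by
        rw [Function.update_of_ne (Finset.ne_of_mem_erase hi)]
    rw [masterFunction, hc, hs,
      prod_update t j s (fun x => ((x - y 0) ^ M 0)⁻¹ * ((x - y 1) ^ M 1)⁻¹), hQev, ← hδ,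
      mul_add δ, add_left_comm, Complex.exp_add (δ * s)]
    ring
  simp only [hK]
  have d1 : HasDerivAt (fun s : ℂ => Complex.exp (δ * s)) (Complex.exp (δ * t j) * (δ * 1)) (t j) :=
    ((hasDerivAt_id (t j)).const_mul δ).cexp
  have dpow : ∀ b : Fin 2, HasDerivAt (fun s : ℂ => ((s - y b) ^ M b)⁻¹)
      (-(M b : ℂ) / (t j - y b) * ((t j - y b) ^ M b)⁻¹) (t j) := by
    intro b
    have hb : t j - y b ≠ 0 := sub_ne_zero.2 (ht.2 j b)
    have := ((((hasDerivAt_id (t j)).sub_const (y b)).pow (M b))).inv (by simpa using pow_ne_zero _ hb)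
    refine this.congr_deriv ?_
    simp only [id, mul_one, Pi.pow_apply]
    rcases Nat.eq_zero_or_pos (M b) with h | h
    · simp [h]
    · obtain ⟨e, he⟩ : ∃ e, M b = e + 1 := ⟨M b - 1, by omega⟩
      rw [he, Nat.add_sub_cancel]
      field_simp
      ring
  have d2 := (Q.hasDerivAt (t j)).pow 2
  have := ((d1.mul ((dpow 0).mul (dpow 1))).mul d2).const_mul K
  refine this.congr_deriv ?_
  simp only [Pi.mul_apply, Pi.pow_apply]
  have hode' : 2 * (derivative Q).eval (t j) + δ * Q.eval (t j) =
      (M 0 / (t j - y 0) + M 1 / (t j - y 1)) * Q.eval (t j) := by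
    field_simp
    linear_combination hode
  push_cast
  linear_combination (K * Complex.exp (δ * t j) * (((t j - y 0) ^ M 0)⁻¹ * ((t j - y 1) ^ M 1)⁻¹) *
    Q.eval (t j)) * hode'

/-! ### Coefficients of the universal vector -/

/-- Some permutation moves `s` onto the last `s.card` positions, so a sum over all permutations sees
only the cardinality of `s`. -/
theorem exists_perm_mem_iff {k : ℕ} (s : Finset (Fin k)) :
    ∃ τ : Equiv.Perm (Fin k), ∀ j, j ∈ s ↔ ¬ ((τ j : ℕ) < k - s.card) := by
  set u : Finset (Fin k) := Finset.univ.filter (fun j => ¬ ((j : ℕ) < k - s.card)) with hu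
  have hs : s.card ≤ k := by simpa using s.card_le_univ
  have hcard : u.card = s.card := by
    have h1 := Finset.card_filter_add_card_filter_not (s := (Finset.univ : Finset (Fin k)))
      (fun j : Fin k => (j : ℕ) < k - s.card)
    rw [Fin.card_filter_val_lt] at h1
    simp only [Finset.card_univ, Fintype.card_fin, ← hu] at h1
    omega
  have e : {x // x ∈ s} ≃ {x // x ∈ u} := Finset.equivOfCardEq hcard.symm
  refine ⟨e.extendSubtype, fun j => ?_⟩
  have : e.extendSubtype j ∈ u ↔ j ∈ s := by
    constructor
    · intro h
      by_contra hj
      exact e.extendSubtype_not_mem j hj h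
    · exact e.extendSubtype_mem j
  generalize e.extendSubtype j = x at this ⊢
  rw [← this, hu]
  simp

theorem sum_perm_prod_ite {k : ℕ} (u v : Fin k → ℂ) (s : Finset (Fin k)) :
    ∑ σ : Equiv.Perm (Fin k), ∏ j, (if j ∈ s then v (σ j) else u (σ j)) =
      ∑ σ : Equiv.Perm (Fin k), ∏ j : Fin k,
        (if (j : ℕ) < k - s.card then u (σ j) else v (σ j)) := by
  obtain ⟨τ, hτ⟩ := exists_perm_mem_iff s
  rw [← Equiv.sum_comp (Equiv.mulRight τ)]
  refine Finset.sum_congr rfl fun σ _ => ?_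
  rw [← Equiv.prod_comp τ (fun j : Fin k => if (j : ℕ) < k - s.card then u (σ j) else v (σ j))]
  refine Finset.prod_congr rfl fun j _ => ?_
  simp only [hτ, Equiv.coe_mulRight, Equiv.Perm.mul_apply, ite_not]

/-- Averaging the expanded product over permutations makes all `k.choose i` subsets of size `i`
contribute equally. -/
theorem factorial_smul_prod_add {k : ℕ} (u v : Fin k → ℂ) (A B : ℂ[X]) :
    C (k.factorial : ℂ) * ∏ j, (C (u j) * A + C (v j) * B) =
      ∑ i ∈ Finset.range (k + 1), C ((k.choose i : ℂ) * ∑ σ : Equiv.Perm (Fin k), ∏ j : Fin k,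
        (if (j : ℕ) < k - i then u (σ j) else v (σ j))) * (A ^ (k - i) * B ^ i) := by
  have h1 : C (k.factorial : ℂ) * ∏ j, (C (u j) * A + C (v j) * B) =
      ∑ σ : Equiv.Perm (Fin k), ∏ j, (C (v (σ j)) * B + C (u (σ j)) * A) := by
    have : ∀ σ : Equiv.Perm (Fin k), ∏ j, (C (v (σ j)) * B + C (u (σ j)) * A) =
        ∏ j, (C (u j) * A + C (v j) * B) := fun σ => by
      rw [← Equiv.prod_comp σ (fun j => C (u j) * A + C (v j) * B)]
      exact Finset.prod_congr rfl fun j _ => add_comm _ _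
    simp [this, Fintype.card_perm]
  rw [h1]
  simp only [Finset.prod_add]
  rw [Finset.sum_comm, Finset.sum_powerset, Finset.card_univ, Fintype.card_fin]
  refine Finset.sum_congr rfl fun i _ => ?_
  have h2 : ∀ s ∈ Finset.powersetCard i (Finset.univ : Finset (Fin k)),
      ∑ σ : Equiv.Perm (Fin k), (∏ j ∈ s, C (v (σ j)) * B) * ∏ j ∈ Finset.univ \ s,
        C (u (σ j)) * A = C (∑ σ : Equiv.Perm (Fin k), ∏ j : Fin k,
        (if (j : ℕ) < k - i then u (σ j) else v (σ j))) * (A ^ (k - i) * B ^ i) := by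
    intro s hs
    have hs := (Finset.mem_powersetCard.1 hs).2
    rw [← hs, ← sum_perm_prod_ite, map_sum, Finset.sum_mul]
    refine Finset.sum_congr rfl fun σ _ => ?_
    rw [Finset.prod_mul_distrib, Finset.prod_mul_distrib, Finset.prod_const, Finset.prod_const,
      Finset.card_sdiff_of_subset (Finset.subset_univ s), Finset.card_univ, Fintype.card_fin,
      Finset.prod_ite, map_mul, map_prod, map_prod]
    have e1 : Finset.univ.filter (fun j => j ∈ s) = s := by ext; simp
    have e2 : Finset.univ.filter (fun j => j ∉ s) = Finset.univ \ s := by ext; simp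
    rw [e1, e2]
    ring
  rw [Finset.sum_congr rfl h2, Finset.sum_const, Finset.card_powersetCard, Finset.card_univ,
    Fintype.card_fin, nsmul_eq_mul, C_mul, ← mul_assoc]
  simp

/-- The coefficients of the universal vector are, up to signs and a common factor, the coefficients
of the two-point expansion of the polynomial with the given roots. -/
theorem betheCoeff_eq {y : Fin 2 → ℂ} (hy : y 0 ≠ y 1) {k : ℕ} {c : ℕ → ℂ} {t : Fin k → ℂ}
    (hp : Represents (twoPointPoly y k c) t) (ht : IsAdmissible y t) :
    ∃ κ : ℂ, κ ≠ 0 ∧ ∀ i ≤ k, betheCoeff y t i = κ * ((-1) ^ i * c i) := by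
  obtain ⟨a, ha, hpa⟩ := hp
  have hne : ∀ j b, t j - y b ≠ 0 := fun j b => sub_ne_zero.2 (ht.2 j b)
  have hy' : y 0 - y 1 ≠ 0 := sub_ne_zero.2 hy
  set G : ℂ := ∏ j, ((t j - y 0) * (t j - y 1) / (y 0 - y 1)) with hG
  have hG0 : G ≠ 0 := Finset.prod_ne_zero_iff.2 fun j _ =>
    div_ne_zero (mul_ne_zero (hne j 0) (hne j 1)) hy'
  -- Linear interpolation of `X - t j` at `y 0` and `y 1`. The minus sign before `X - C (y 1)` is
  -- the source of the signs `(-1) ^ i`.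
  have hlin : ∀ j, (X - C (t j) : ℂ[X]) = C ((t j - y 0) * (t j - y 1) / (y 0 - y 1)) *
      (C ((t j - y 0)⁻¹) * (X - C (y 0)) + C ((t j - y 1)⁻¹) * (-(X - C (y 1)))) := by
    intro j
    have e1 : (t j - y 0) * (t j - y 1) / (y 0 - y 1) * (t j - y 0)⁻¹ =
      (t j - y 1) / (y 0 - y 1) := by have := hne j 0; field_simp
    have e2 : (t j - y 0) * (t j - y 1) / (y 0 - y 1) * (t j - y 1)⁻¹ =
      (t j - y 1) / (y 0 - y 1) - 1 := by have := hne j 1; field_simp; ring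
    have e3 : C ((t j - y 1) / (y 0 - y 1)) * C (y 0 - y 1) = C (t j) - C (y 1) := by
      rw [← C_mul, ← C_sub]; congr 1; field_simp
    rw [mul_add, ← mul_assoc, ← mul_assoc, ← C_mul, ← C_mul, e1, e2, C_sub, C_1]
    rw [C_sub] at e3
    linear_combination e3
  have h1 : C (k.factorial : ℂ) * twoPointPoly y k c = C (a * G) *
      ∑ i ∈ Finset.range (k + 1), C ((k.choose i : ℂ) * betheCoeff y t i) *
        ((X - C (y 0)) ^ (k - i) * (-(X - C (y 1))) ^ i) := by
    rw [hpa, Finset.prod_congr rfl fun j _ => hlin j, Finset.prod_mul_distrib, ← map_prod, ← hG]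
    simp only [betheCoeff]
    rw [← factorial_smul_prod_add (fun j => (t j - y 0)⁻¹) (fun j => (t j - y 1)⁻¹), C_mul]
    ring
  have h2 : ∑ i ∈ Finset.range (k + 1),
      C (k.choose i * c i - a * G * (k.choose i * betheCoeff y t i) * (-1) ^ i) *
        ((X - C (y 0)) ^ (k - i) * (X - C (y 1)) ^ i) = 0 := by
    rw [← sub_eq_zero.2 h1, twoPointPoly, Finset.mul_sum, Finset.mul_sum, ← Finset.sum_sub_distrib]
    refine Finset.sum_congr rfl fun i hi => ?_
    have hi := Finset.mem_range_succ_iff.1 hi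
    have e1 : (k.choose i : ℂ) * c i =
        k.factorial * (c i / ((k - i).factorial * i.factorial)) := by
      rw [Nat.cast_choose ℂ hi, mul_comm (i.factorial : ℂ)]
      ring
    rw [neg_pow (X - C (y 1)), C_sub, e1]
    simp only [C_mul, map_pow, map_neg, map_one]
    ring
  refine ⟨(a * G)⁻¹, inv_ne_zero (mul_ne_zero ha hG0), fun i hi => ?_⟩
  have h3 := sum_X_sub_C_pow_mul_eq_zero hy k _ h2 i hi
  have h4 : (k.choose i : ℂ) ≠ 0 := by exact_mod_cast (Nat.choose_pos hi).ne'
  have h5 : c i = a * G * betheCoeff y t i * (-1) ^ i :=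
    mul_left_cancel₀ h4 (by linear_combination h3)
  have h6 : ((-1 : ℂ) ^ i) * (-1) ^ i = 1 := by rw [← mul_pow]; simp
  have h7 : a * G ≠ 0 := mul_ne_zero ha hG0
  rw [h5, show (a * G)⁻¹ * ((-1) ^ i * (a * G * betheCoeff y t i * (-1) ^ i)) =
    ((a * G)⁻¹ * (a * G)) * betheCoeff y t i * ((-1) ^ i * (-1) ^ i) by ring, h6,
    inv_mul_cancel₀ h7, one_mul, mul_one]

/-! ### Monomials in the tensor square -/

/-- The exponent of `X^α ⊗ X^β` in the variables `x_{ai}`. -/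
noncomputable def jointExp (α β : Fin 2 →₀ ℕ) : Fin 2 × Fin 2 →₀ ℕ :=
  Finsupp.equivFunOnFinite.symm fun x => if x.1 = 0 then α x.2 else β x.2

@[simp] theorem jointExp_zero (α β : Fin 2 →₀ ℕ) (i : Fin 2) : jointExp α β (0, i) = α i := rfl

@[simp] theorem jointExp_one (α β : Fin 2 →₀ ℕ) (i : Fin 2) : jointExp α β (1, i) = β i := rfl

theorem rowIso_monomial (α β : Fin 2 →₀ ℕ) (a b : ℂ) :
    rowIso (MvPolynomial.monomial α a ⊗ₜ[ℂ] MvPolynomial.monomial β b) =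
      MvPolynomial.monomial (jointExp α β) (a * b) := by
  rw [rowIso_tmul, MvPolynomial.rename_monomial, MvPolynomial.rename_monomial,
    MvPolynomial.monomial_mul]
  suffices h : Finsupp.mapDomain (fun i => ((0 : Fin 2), i)) α +
      Finsupp.mapDomain (fun i => ((1 : Fin 2), i)) β = jointExp α β by rw [h]
  have inj : ∀ x : Fin 2, Function.Injective (fun i : Fin 2 => (x, i)) :=
    fun x i j h => (Prod.mk.inj h).2
  ext ⟨x, i⟩
  fin_cases x
  · have h1 := Finsupp.mapDomain_apply (inj 0) α i
    have h2 := Finsupp.mapDomain_of_notMem_range (f := fun i : Fin 2 => ((1 : Fin 2), i)) β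
      ((0 : Fin 2), i) (by simp)
    simp only [Finsupp.add_apply, Fin.zero_eta]
    rw [h1, h2]
    simp
  · have h1 := Finsupp.mapDomain_apply (inj 1) β i
    have h2 := Finsupp.mapDomain_of_notMem_range (f := fun i : Fin 2 => ((0 : Fin 2), i)) α
      ((1 : Fin 2), i) (by simp)
    simp only [Finsupp.add_apply, Fin.mk_one]
    rw [h1, h2]
    simp

theorem tensor_linearMap_ext {N : Type*} [AddCommMonoid N] [Module ℂ N]
    {f g : Pol ⊗[ℂ] Pol →ₗ[ℂ] N}
    (h : ∀ α β, f (MvPolynomial.monomial α 1 ⊗ₜ MvPolynomial.monomial β 1) =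
      g (MvPolynomial.monomial α 1 ⊗ₜ MvPolynomial.monomial β 1)) : f = g := by
  apply TensorProduct.ext
  refine MvPolynomial.linearMap_ext fun α => ?_
  ext1
  refine MvPolynomial.linearMap_ext fun β => ?_
  ext1
  simpa using h α β

theorem polE_monomial (i : Fin 2) (α : Fin 2 →₀ ℕ) (a : ℂ) :
    polE i i (MvPolynomial.monomial α a) = (α i : ℂ) • MvPolynomial.monomial α a := by
  simp only [polE, LinearMap.comp_apply, LinearMap.mulLeft_apply]
  have := MvPolynomial.X_mul_pderiv_monomial (R := ℂ) (i := i) (m := α) (r := a)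
  refine (this.trans ?_)
  rw [← Nat.cast_smul_eq_nsmul ℂ]

theorem coeff_rowIso_map_polE_left (i : Fin 2) (x : Pol ⊗[ℂ] Pol) (s : Fin 2 × Fin 2 →₀ ℕ) :
    (rowIso (TensorProduct.map (polE i i) LinearMap.id x)).coeff s =
      (s (0, i) : ℂ) * (rowIso x).coeff s := by
  have : (MvPolynomial.lcoeff ℂ s) ∘ₗ rowIso.toLinearMap ∘ₗ
      TensorProduct.map (polE i i) LinearMap.id =
      (s (0, i) : ℂ) • ((MvPolynomial.lcoeff ℂ s) ∘ₗ rowIso.toLinearMap) := by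
    refine tensor_linearMap_ext fun α β => ?_
    simp only [LinearMap.comp_apply, TensorProduct.map_tmul, polE_monomial, LinearMap.id_apply,
      LinearEquiv.coe_coe, LinearMap.smul_apply, ← TensorProduct.smul_tmul', map_smul,
      rowIso_monomial, MvPolynomial.lcoeff_apply, MvPolynomial.coeff_monomial]
    split_ifs with h
    · subst h; simp
    · simp
  exact LinearMap.congr_fun this x

theorem coeff_rowIso_map_polE_right (i : Fin 2) (x : Pol ⊗[ℂ] Pol) (s : Fin 2 × Fin 2 →₀ ℕ) :
    (rowIso (TensorProduct.map LinearMap.id (polE i i) x)).coeff s =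
      (s (1, i) : ℂ) * (rowIso x).coeff s := by
  have : (MvPolynomial.lcoeff ℂ s) ∘ₗ rowIso.toLinearMap ∘ₗ
      TensorProduct.map LinearMap.id (polE i i) =
      (s (1, i) : ℂ) • ((MvPolynomial.lcoeff ℂ s) ∘ₗ rowIso.toLinearMap) := by
    refine tensor_linearMap_ext fun α β => ?_
    simp only [LinearMap.comp_apply, TensorProduct.map_tmul, polE_monomial, LinearMap.id_apply,
      LinearEquiv.coe_coe, LinearMap.smul_apply, TensorProduct.tmul_smul, map_smul,
      rowIso_monomial, MvPolynomial.lcoeff_apply, MvPolynomial.coeff_monomial]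
    split_ifs with h
    · subst h; simp
    · simp
  exact LinearMap.congr_fun this x

theorem polE_add_of_mem_irrep {k : ℕ} {p : Pol} (hp : p ∈ irrep k) :
    (polE 0 0 + polE 1 1) p = (k : ℂ) • p := by
  have h := MvPolynomial.IsHomogeneous.sum_X_mul_pderiv
    ((MvPolynomial.mem_homogeneousSubmodule _ _).1 hp)
  rw [Fin.sum_univ_two] at h
  simpa [polE, Nat.cast_smul_eq_nsmul] using h

/-- The Euler operator `E₁₁ + E₂₂` acts on `irrep k` as `k`, which forces the row degrees of every
monomial; conversely each such monomial is a pure tensor of homogeneous monomials. -/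
theorem mem_range_map_irrep_iff (m : Fin 2 → ℕ) (x : Pol ⊗[ℂ] Pol) :
    x ∈ LinearMap.range (TensorProduct.map (irrep (m 0)).subtype (irrep (m 1)).subtype) ↔
      ∀ s, (rowIso x).coeff s ≠ 0 → s (0, 0) + s (0, 1) = m 0 ∧ s (1, 0) + s (1, 1) = m 1 := by
  constructor
  · rintro ⟨y, rfl⟩ s hs
    have h0 : (TensorProduct.map (polE 0 0 + polE 1 1) LinearMap.id) ∘ₗ
        TensorProduct.map (irrep (m 0)).subtype (irrep (m 1)).subtype =
        (m 0 : ℂ) • TensorProduct.map (irrep (m 0)).subtype (irrep (m 1)).subtype := by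
      refine TensorProduct.ext' fun p q => ?_
      simp only [LinearMap.comp_apply, TensorProduct.map_tmul, Submodule.subtype_apply,
        polE_add_of_mem_irrep p.2, LinearMap.smul_apply, TensorProduct.smul_tmul',
        LinearMap.id_apply]
    have h1 : (TensorProduct.map LinearMap.id (polE 0 0 + polE 1 1)) ∘ₗ
        TensorProduct.map (irrep (m 0)).subtype (irrep (m 1)).subtype =
        (m 1 : ℂ) • TensorProduct.map (irrep (m 0)).subtype (irrep (m 1)).subtype := by
      refine TensorProduct.ext' fun p q => ?_
      simp only [LinearMap.comp_apply, TensorProduct.map_tmul, Submodule.subtype_apply,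
        polE_add_of_mem_irrep q.2, LinearMap.smul_apply, TensorProduct.tmul_smul,
        LinearMap.id_apply]
    have e0 := congrArg (fun w => (rowIso w).coeff s) (LinearMap.congr_fun h0 y)
    have e1 := congrArg (fun w => (rowIso w).coeff s) (LinearMap.congr_fun h1 y)
    simp only [LinearMap.comp_apply, TensorProduct.map_add_left, TensorProduct.map_add_right,
      LinearMap.add_apply, map_add, MvPolynomial.coeff_add, coeff_rowIso_map_polE_left,
      coeff_rowIso_map_polE_right, LinearMap.smul_apply, map_smul, MvPolynomial.coeff_smul,
      smul_eq_mul, ← add_mul] at e0 e1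
    exact ⟨by exact_mod_cast mul_right_cancel₀ hs e0, by exact_mod_cast mul_right_cancel₀ hs e1⟩
  · intro h
    have hx : x = rowIso.symm (∑ s ∈ (rowIso x).support,
        MvPolynomial.monomial s ((rowIso x).coeff s)) := by
      rw [← MvPolynomial.as_sum, LinearEquiv.symm_apply_apply]
    rw [hx, map_sum]
    refine Submodule.sum_mem _ fun s hs => ?_
    obtain ⟨h0, h1⟩ := h s (MvPolynomial.mem_support_iff.1 hs)
    set α : Fin 2 →₀ ℕ := Finsupp.equivFunOnFinite.symm fun i => s (0, i) with hα
    set β : Fin 2 →₀ ℕ := Finsupp.equivFunOnFinite.symm fun i => s (1, i) with hβ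
    have hs' : s = jointExp α β := by
      ext ⟨x, i⟩
      fin_cases x <;> rfl
    have : rowIso.symm (MvPolynomial.monomial s ((rowIso x).coeff s)) =
        MvPolynomial.monomial α ((rowIso x).coeff s) ⊗ₜ MvPolynomial.monomial β 1 := by
      rw [LinearEquiv.symm_apply_eq, rowIso_monomial, ← hs', mul_one]
    rw [this]
    refine ⟨(⟨MvPolynomial.monomial α ((rowIso x).coeff s),
        MvPolynomial.isHomogeneous_monomial _ ?_⟩ : irrep (m 0)) ⊗ₜ
      (⟨MvPolynomial.monomial β 1, MvPolynomial.isHomogeneous_monomial _ ?_⟩ : irrep (m 1)),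
      by simp⟩
    · rw [Finsupp.degree_eq_sum, Fin.sum_univ_two]; exact h0
    · rw [Finsupp.degree_eq_sum, Fin.sum_univ_two]; exact h1

/-- A weight space is spanned by monomials whose 2×2 exponent matrix has row sums `m` and column
sums `n`. The duality then becomes transposition and the Weyl map the exchange of columns. -/
theorem mem_weightSpace_iff (m n : Fin 2 → ℕ) (x : Pol ⊗[ℂ] Pol) :
    x ∈ weightSpace m n ↔ ∀ s, (rowIso x).coeff s ≠ 0 →
      (s (0, 0) + s (0, 1) = m 0 ∧ s (1, 0) + s (1, 1) = m 1) ∧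
      (s (0, 0) + s (1, 0) = n 0 ∧ s (0, 1) + s (1, 1) = n 1) := by
  have key : ∀ i, tensorE i i x = (n i : ℂ) • x ↔
      ∀ s, (rowIso x).coeff s ≠ 0 → s (0, i) + s (1, i) = n i := by
    intro i
    rw [← rowIso.injective.eq_iff, MvPolynomial.ext_iff]
    refine forall_congr' fun s => ?_
    simp only [tensorE, LinearMap.add_apply, map_add, MvPolynomial.coeff_add,
      coeff_rowIso_map_polE_left, coeff_rowIso_map_polE_right, map_smul, MvPolynomial.coeff_smul,
      smul_eq_mul, ← add_mul]
    constructor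
    · intro h hs
      exact_mod_cast mul_right_cancel₀ hs h
    · intro h
      by_cases hs : (rowIso x).coeff s = 0
      · simp [hs]
      · rw [← h hs]; push_cast; rfl
  rw [weightSpace, Submodule.mem_inf, mem_range_map_irrep_iff, Submodule.mem_iInf]
  simp only [Module.End.mem_eigenspace_iff, key, Fin.forall_fin_two]
  constructor
  · rintro ⟨h1, h2, h3⟩ s hs
    exact ⟨h1 s hs, h2 s hs, h3 s hs⟩
  · intro h
    exact ⟨fun s hs => (h s hs).1, fun s hs => (h s hs).2.1, fun s hs => (h s hs).2.2⟩

theorem forall_coeff_rename_iff (e : Fin 2 × Fin 2 ≃ Fin 2 × Fin 2)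
    (P : MvPolynomial (Fin 2 × Fin 2) ℂ) (F : (Fin 2 × Fin 2 → ℕ) → Prop) :
    (∀ s, (MvPolynomial.rename e P).coeff s ≠ 0 → F s) ↔
      ∀ s, P.coeff s ≠ 0 → F (fun x => s (e.symm x)) := by
  have h : ∀ s : Fin 2 × Fin 2 →₀ ℕ, ((s.mapDomain e : _ →₀ ℕ) : _ → ℕ) =
      fun x => s (e.symm x) := by
    intro s
    ext x
    conv_lhs => rw [← e.apply_symm_apply x]
    exact Finsupp.mapDomain_apply e.injective s (e.symm x)
  constructor
  · intro H s hs
    rw [← h]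
    exact H _ (by rwa [MvPolynomial.coeff_rename_mapDomain _ e.injective])
  · intro H s hs
    obtain ⟨u, rfl, hu⟩ := MvPolynomial.coeff_rename_ne_zero _ _ _ hs
    rw [h]
    exact H u hu

theorem rowIso_weylIso (x : Pol ⊗[ℂ] Pol) : rowIso (weylIso x) =
    MvPolynomial.rename ((Equiv.refl (Fin 2)).prodCongr (Equiv.swap (0 : Fin 2) 1)) (rowIso x) := by
  induction x using TensorProduct.induction_on with
  | zero => simp
  | add x y hx hy => simp only [map_add, hx, hy]
  | tmul p q =>
    simp only [weylIso, TensorProduct.congr_tmul, rowIso_tmul]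
    simp [MvPolynomial.rename_rename, Function.comp_def]

theorem rowIso_dualityIso (x : Pol ⊗[ℂ] Pol) : rowIso (dualityIso x) =
    MvPolynomial.rename (Equiv.prodComm (Fin 2) (Fin 2)) (rowIso x) := by
  simp [dualityIso, colIso]

theorem weylIso_mem_iff {m n : Fin 2 → ℕ} {x : Pol ⊗[ℂ] Pol} :
    weylIso x ∈ weightSpace m (swapPair n) ↔ x ∈ weightSpace m n := by
  rw [mem_weightSpace_iff, mem_weightSpace_iff, rowIso_weylIso, forall_coeff_rename_iff _ _
    (fun s => (s (0, 0) + s (0, 1) = m 0 ∧ s (1, 0) + s (1, 1) = m 1) ∧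
      (s (0, 0) + s (1, 0) = swapPair n 0 ∧ s (0, 1) + s (1, 1) = swapPair n 1))]
  refine forall_congr' fun s => imp_congr_right fun _ => ?_
  simp [swapPair]
  omega

theorem dualityIso_mem_iff {m n : Fin 2 → ℕ} {x : Pol ⊗[ℂ] Pol} :
    dualityIso x ∈ weightSpace m n ↔ x ∈ weightSpace n m := by
  rw [mem_weightSpace_iff, mem_weightSpace_iff, rowIso_dualityIso, forall_coeff_rename_iff _ _
    (fun s => (s (0, 0) + s (0, 1) = m 0 ∧ s (1, 0) + s (1, 1) = m 1) ∧
      (s (0, 0) + s (1, 0) = n 0 ∧ s (0, 1) + s (1, 1) = n 1))]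
  refine forall_congr' fun s => imp_congr_right fun _ => ?_
  simp
  omega

theorem map_weylIso_weightSpace (m n : Fin 2 → ℕ) :
    (weightSpace m n).map weylIso.toLinearMap = weightSpace m (swapPair n) := by
  ext y
  rw [Submodule.mem_map]
  constructor
  · rintro ⟨x, hx, rfl⟩; exact weylIso_mem_iff.2 hx
  · intro hy
    refine ⟨weylIso.symm y, weylIso_mem_iff.1 ?_, ?_⟩ <;> simp [hy]

theorem map_dualityIso_weightSpace (m n : Fin 2 → ℕ) :
    (weightSpace n m).map dualityIso.toLinearMap = weightSpace m n := by
  ext y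
  rw [Submodule.mem_map]
  constructor
  · rintro ⟨x, hx, rfl⟩; exact dualityIso_mem_iff.2 hx
  · intro hy
    refine ⟨dualityIso.symm y, dualityIso_mem_iff.1 ?_, ?_⟩ <;> simp [hy]

/-! ### The vectors `betheSum` -/

theorem lowered_eq_monomial {k j : ℕ} (h : j ≤ k) : lowered k j =
    MvPolynomial.monomial (Finsupp.single 0 (k - j) + Finsupp.single 1 j) (k.choose j : ℂ) := by
  rw [lowered_eq h, MvPolynomial.X_pow_eq_monomial, MvPolynomial.X_pow_eq_monomial,
    MvPolynomial.monomial_mul, MvPolynomial.smul_monomial]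
  simp

/-- The exponent of `E_{21}^{k-i} v_{m_1} ⊗ E_{21}^i v_{m_2}`. -/
noncomputable def loweredExp (m : Fin 2 → ℕ) (k i : ℕ) : Fin 2 × Fin 2 →₀ ℕ :=
  jointExp (Finsupp.single 0 (m 0 - (k - i)) + Finsupp.single 1 (k - i))
    (Finsupp.single 0 (m 1 - i) + Finsupp.single 1 i)

theorem rowIso_lowered {m : Fin 2 → ℕ} {k i : ℕ} (h₀ : k - i ≤ m 0) (h₁ : i ≤ m 1) :
    rowIso (lowered (m 0) (k - i) ⊗ₜ lowered (m 1) i) = MvPolynomial.monomial (loweredExp m k i)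
      (((m 0).choose (k - i) : ℂ) * ((m 1).choose i : ℂ)) := by
  rw [lowered_eq_monomial h₀, lowered_eq_monomial h₁, rowIso_monomial]
  rfl

theorem betheSum_mem {m n : Fin 2 → ℕ} (hnm : n 0 + n 1 = m 0 + m 1) (c : ℕ → ℂ) :
    betheSum m (n 1) c ∈ weightSpace m n := by
  refine Submodule.sum_mem _ fun i hi => Submodule.smul_mem _ _ ?_
  rw [Finset.mem_Icc, le_min_iff] at hi
  rw [mem_weightSpace_iff, rowIso_lowered (by omega) (by omega)]
  intro s hs
  rw [MvPolynomial.coeff_monomial] at hs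
  obtain rfl : loweredExp m (n 1) i = s := by
    by_contra h; simp [h] at hs
  simp [loweredExp]
  omega

/-- Distinct `i` give distinct monomials, told apart by their exponent at `(1, 1)`. -/
theorem coeff_rowIso_betheSum {m : Fin 2 → ℕ} {k : ℕ} (c : ℕ → ℂ) {i : ℕ}
    (hi : i ∈ Finset.Icc (k - m 0) (min (m 1) k)) :
    (rowIso (betheSum m k c)).coeff (loweredExp m k i) =
      c i * (((m 0).choose (k - i) : ℂ) * ((m 1).choose i : ℂ)) := by
  rw [betheSum, map_sum, MvPolynomial.coeff_sum, Finset.sum_eq_single_of_mem i hi]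
  · rw [Finset.mem_Icc, le_min_iff] at hi
    rw [map_smul, rowIso_lowered (by omega) (by omega)]
    simp
  · intro j hj hji
    rw [Finset.mem_Icc, le_min_iff] at hj
    rw [map_smul, rowIso_lowered (by omega) (by omega), MvPolynomial.coeff_smul,
      MvPolynomial.coeff_monomial, if_neg, smul_zero]
    intro h
    have := DFunLike.congr_fun h (1, 1)
    simp [loweredExp] at this
    exact hji this

theorem betheSum_ne_zero {m : Fin 2 → ℕ} {k : ℕ} {c : ℕ → ℂ} {i : ℕ}
    (hi : i ∈ Finset.Icc (k - m 0) (min (m 1) k)) (hc : c i ≠ 0) : betheSum m k c ≠ 0 := by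
  intro h
  have := coeff_rowIso_betheSum c hi
  rw [h, map_zero, MvPolynomial.coeff_zero] at this
  rw [Finset.mem_Icc, le_min_iff] at hi
  have h1 : ((m 0).choose (k - i) : ℂ) ≠ 0 := by
    exact_mod_cast (Nat.choose_pos (by omega)).ne'
  have h2 : ((m 1).choose i : ℂ) ≠ 0 := by exact_mod_cast (Nat.choose_pos (by omega)).ne'
  exact mul_ne_zero hc (mul_ne_zero h1 h2) this.symm

theorem betheSum_congr {m : Fin 2 → ℕ} {k : ℕ} {c c' : ℕ → ℂ}
    (h : ∀ i ∈ Finset.Icc (k - m 0) (min (m 1) k), c i = c' i) :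
    betheSum m k c = betheSum m k c' :=
  Finset.sum_congr rfl fun i hi => by rw [h i hi]

theorem betheSum_smul (m : Fin 2 → ℕ) (k : ℕ) (a : ℂ) (c : ℕ → ℂ) :
    betheSum m k (fun i => a * c i) = a • betheSum m k c := by
  simp only [betheSum, Finset.smul_sum, smul_smul]

theorem weylIso_betheSum {m : Fin 2 → ℕ} {k k' : ℕ} (hk : k' + k = m 0 + m 1) (c : ℕ → ℂ) :
    weylIso (betheSum m k c) = betheSum m k' (fun i => c (m 1 - i)) := by
  rw [betheSum, map_sum, betheSum]
  refine Finset.sum_bij' (fun i _ => m 1 - i) (fun i _ => m 1 - i) ?_ ?_ ?_ ?_ ?_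
  · intro i hi; simp only [Finset.mem_Icc, le_min_iff] at hi ⊢; omega
  · intro i hi; simp only [Finset.mem_Icc, le_min_iff] at hi ⊢; omega
  · intro i hi; simp only [Finset.mem_Icc, le_min_iff] at hi; omega
  · intro i hi; simp only [Finset.mem_Icc, le_min_iff] at hi; omega
  · intro i hi
    simp only [Finset.mem_Icc, le_min_iff] at hi
    rw [map_smul, weylIso_formula (by omega) (by omega) (by omega),
      show m 1 - (m 1 - i) = i by omega, show k' - (m 1 - i) = m 0 + i - k by omega]

theorem dualityIso_tmul_X_pow (a b c d : ℕ) :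
    dualityIso (((MvPolynomial.X 0 : Pol) ^ a * MvPolynomial.X 1 ^ b) ⊗ₜ
      ((MvPolynomial.X 0 : Pol) ^ c * MvPolynomial.X 1 ^ d)) =
    ((MvPolynomial.X 0 : Pol) ^ a * MvPolynomial.X 1 ^ c) ⊗ₜ
      ((MvPolynomial.X 0 : Pol) ^ b * MvPolynomial.X 1 ^ d) := by
  apply rowIso.injective
  rw [dualityIso, LinearEquiv.trans_apply, LinearEquiv.apply_symm_apply, colIso_tmul, rowIso_tmul]
  simp
  ring

/-- The exponent matrix and its transpose have the same four entries, so the ratio of binomial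
products is free of `i` and only the factorials of the row sums remain. -/
theorem dualityIso_betheSum {m n : Fin 2 → ℕ} (hnm : n 0 + n 1 = m 0 + m 1) (c : ℕ → ℂ) :
    dualityIso (betheSum n (m 1) c) = (((n 0).factorial * (n 1).factorial : ℂ) /
      ((m 0).factorial * (m 1).factorial)) • betheSum m (n 1) c := by
  have hI : Finset.Icc (m 1 - n 0) (min (n 1) (m 1)) =
      Finset.Icc (n 1 - m 0) (min (m 1) (n 1)) := by
    rw [min_comm]; congr 1; omega
  rw [betheSum, map_sum, betheSum, Finset.smul_sum, hI]
  refine Finset.sum_congr rfl fun i hi => ?_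
  simp only [Finset.mem_Icc, le_min_iff] at hi
  rw [map_smul, smul_comm]
  congr 1
  rw [lowered_eq (show m 1 - i ≤ n 0 by omega), lowered_eq (show i ≤ n 1 by omega),
    lowered_eq (show n 1 - i ≤ m 0 by omega), lowered_eq (show i ≤ m 1 by omega)]
  simp only [← TensorProduct.smul_tmul', TensorProduct.tmul_smul, map_smul, smul_smul]
  rw [dualityIso_tmul_X_pow, show n 0 - (m 1 - i) = m 0 - (n 1 - i) by omega]
  congr 1
  rw [Nat.cast_choose ℂ (show m 1 - i ≤ n 0 by omega), Nat.cast_choose ℂ (show i ≤ n 1 by omega),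
    Nat.cast_choose ℂ (show n 1 - i ≤ m 0 by omega), Nat.cast_choose ℂ (show i ≤ m 1 by omega),
    show n 0 - (m 1 - i) = m 0 - (n 1 - i) by omega]
  have hf : ∀ j : ℕ, (j.factorial : ℂ) ≠ 0 := fun j => by exact_mod_cast j.factorial_ne_zero
  have := hf (m 0); have := hf (m 1); have := hf i; have := hf (m 1 - i); have := hf (n 1 - i)
  have := hf (m 0 - (n 1 - i))
  field_simp

/-! ### The Wronskian of a special space -/

theorem hasDerivAt_quasiPoly (p : ℂ[X]) (μ x : ℂ) :
    HasDerivAt (quasiPoly p μ) (quasiPoly (derivative p + C μ * p) μ x) x := by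
  have h : HasDerivAt (fun x : ℂ => Complex.exp (μ * x)) (Complex.exp (μ * x) * (μ * 1)) x :=
    ((hasDerivAt_id x).const_mul μ).cexp
  refine ((p.hasDerivAt x).mul h).congr_deriv ?_
  simp only [quasiPoly, eval_add, eval_mul, eval_C]
  ring

theorem deriv_quasiPoly (p : ℂ[X]) (μ : ℂ) :
    deriv (quasiPoly p μ) = quasiPoly (derivative p + C μ * p) μ :=
  funext fun x => (hasDerivAt_quasiPoly p μ x).deriv

theorem differentiable_quasiPoly (p : ℂ[X]) (μ : ℂ) : Differentiable ℂ (quasiPoly p μ) :=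
  fun x => (hasDerivAt_quasiPoly p μ x).differentiableAt

theorem mem_quasiSpace_iff {l : Fin 2 → ℂ} {p : Fin 2 → ℂ[X]} {f : ℂ → ℂ} :
    f ∈ quasiSpace l p ↔
      ∃ a : Fin 2 → ℂ, f = a 0 • quasiPoly (p 0) (l 0) + a 1 • quasiPoly (p 1) (l 1) := by
  rw [quasiSpace, Submodule.mem_span_range_iff_exists_fun]
  simp only [Fin.sum_univ_two, eq_comm]

/-- The polynomial factor of the Wronskian of `p₁ e^{l₁ x}` and `p₂ e^{l₂ x}`. -/
noncomputable def wronskianPoly (l : Fin 2 → ℂ) (p : Fin 2 → ℂ[X]) : ℂ[X] :=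
  C (l 1 - l 0) * (p 0 * p 1) + p 0 * derivative (p 1) - derivative (p 0) * p 1

theorem quasiPoly_wronskian (l : Fin 2 → ℂ) (p : Fin 2 → ℂ[X]) (x : ℂ) :
    quasiPoly (p 0) (l 0) x * deriv (quasiPoly (p 1) (l 1)) x -
      deriv (quasiPoly (p 0) (l 0)) x * quasiPoly (p 1) (l 1) x =
    (wronskianPoly l p).eval x * Complex.exp ((l 0 + l 1) * x) := by
  rw [deriv_quasiPoly, deriv_quasiPoly, add_mul, Complex.exp_add]
  simp only [quasiPoly, wronskianPoly, eval_add, eval_sub, eval_mul, eval_C]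
  ring

theorem X_sub_C_pow_dvd_of_le_analyticOrderAt {p : ℂ[X]} {w : ℂ} {k : ℕ}
    (h : (k : ℕ∞) ≤ analyticOrderAt (fun x => p.eval x) w) : (X - C w) ^ k ∣ p := by
  rcases eq_or_ne p 0 with rfl | hp
  · exact dvd_zero _
  obtain ⟨q, hq, hndvd⟩ := exists_eq_pow_rootMultiplicity_mul_and_not_dvd p hp w
  have han : ∀ q : ℂ[X], AnalyticAt ℂ (fun x => q.eval x) w := fun q =>
    q.differentiable.analyticAt w
  have hord : analyticOrderAt (fun x => p.eval x) w = (p.rootMultiplicity w : ℕ∞) := by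
    rw [(han p).analyticOrderAt_eq_natCast]
    refine ⟨fun x => q.eval x, han q, fun h0 => hndvd (dvd_iff_isRoot.2 h0), ?_⟩
    refine Filter.Eventually.of_forall fun x => ?_
    conv_lhs => rw [hq]
    simp
  rw [hord] at h
  exact (le_rootMultiplicity_iff hp).1 (by exact_mod_cast h)

/-- An element `f` of order `1 + k` has `f'` of order `k`, so its Wronskian with either generator is
divisible by `(x - w) ^ k`. -/
theorem pow_dvd_wronskianPoly {l : Fin 2 → ℂ} {p : Fin 2 → ℂ[X]} {w : ℂ} {k : ℕ}
    (h : 1 + k ∈ exponents (quasiSpace l p) w) : (X - C w) ^ k ∣ wronskianPoly l p := by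
  obtain ⟨f, hf, hord⟩ := h
  obtain ⟨a, rfl⟩ := mem_quasiSpace_iff.1 hf
  set f0 := quasiPoly (p 0) (l 0) with hf0
  set f1 := quasiPoly (p 1) (l 1) with hf1
  have d0 : Differentiable ℂ f0 := differentiable_quasiPoly _ _
  have d1 : Differentiable ℂ f1 := differentiable_quasiPoly _ _
  set f := a 0 • f0 + a 1 • f1 with hfdef
  have d : Differentiable ℂ f := (d0.const_smul _).add (d1.const_smul _)
  have hderiv : ∀ x, deriv f x = a 0 * deriv f0 x + a 1 * deriv f1 x := fun x => by
    rw [hfdef, deriv_add ((d0.const_smul _) x) ((d1.const_smul _) x), deriv_const_smul _ (d0 x),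
      deriv_const_smul _ (d1 x)]
    rfl
  have hval : ∀ x, f x = a 0 * f0 x + a 1 * f1 x := fun x => rfl
  have hord' : analyticOrderAt f w = (k : ℕ∞) + 1 := by rw [hord]; push_cast; ring
  have ho1 : (k : ℕ∞) ≤ analyticOrderAt f w := by rw [hord']; exact le_self_add
  have ho2 : (k : ℕ∞) ≤ analyticOrderAt (deriv f) w :=
    (analyticOrderAt_deriv_of_pos (d.analyticAt w) hord').ge
  obtain ⟨g1, ag1, hg1⟩ := (natCast_le_analyticOrderAt (d.analyticAt w)).1 ho1
  obtain ⟨g2, ag2, hg2⟩ := (natCast_le_analyticOrderAt (d.analyticAt w).deriv).1 ho2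
  have hWr := quasiPoly_wronskian l p
  rw [← hf0, ← hf1] at hWr
  set E : ℂ → ℂ := fun x => Complex.exp (-((l 0 + l 1) * x)) with hE
  have aE : AnalyticAt ℂ E w := by fun_prop
  have hEE : ∀ x, Complex.exp ((l 0 + l 1) * x) * E x = 1 := fun x => by
    rw [hE, ← Complex.exp_add, add_neg_cancel, Complex.exp_zero]
  have hW : ∀ x, (wronskianPoly l p).eval x = (f0 x * deriv f1 x - deriv f0 x * f1 x) * E x :=
    fun x => by rw [hWr, mul_assoc, hEE, mul_one]
  have haW : AnalyticAt ℂ (fun x => (wronskianPoly l p).eval x) w :=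
    (wronskianPoly l p).differentiable.analyticAt w
  refine X_sub_C_pow_dvd_of_le_analyticOrderAt ((natCast_le_analyticOrderAt haW).2 ?_)
  -- Replacing one generator by `f` multiplies the Wronskian by the coefficient of that generator in
  -- `f`, up to sign; some coefficient is nonzero because `f` has finite order.
  by_cases h1 : a 1 = 0
  · have h0 : a 0 ≠ 0 := by
      intro h0
      have hz : f = 0 := by rw [hfdef, h0, h1]; simp
      rw [hz, analyticOrderAt_eq_top.2 (by simp)] at hord
      exact ENat.top_ne_natCast _ hord
    refine ⟨fun x => (a 0)⁻¹ * ((g1 x * deriv f1 x - g2 x * f1 x) * E x), ?_, ?_⟩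
    · have := (d1.analyticAt w).deriv
      have := d1.analyticAt w
      fun_prop
    · filter_upwards [hg1, hg2] with x e1 e2
      rw [smul_eq_mul] at *
      have e1' : (a 0) * f0 x + a 1 * f1 x = (x - w) ^ k * g1 x := by rw [← e1, hval]
      have e2' : (a 0) * deriv f0 x + a 1 * deriv f1 x = (x - w) ^ k * g2 x := by
        rw [← e2, hderiv]
      rw [hW]
      field_simp
      linear_combination (E x * deriv f1 x) * e1' - (E x * f1 x) * e2'
  · refine ⟨fun x => (a 1)⁻¹ * ((g2 x * f0 x - g1 x * deriv f0 x) * E x), ?_, ?_⟩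
    · have := (d0.analyticAt w).deriv
      have := d0.analyticAt w
      fun_prop
    · filter_upwards [hg1, hg2] with x e1 e2
      rw [smul_eq_mul] at *
      have e1' : (a 0) * f0 x + a 1 * f1 x = (x - w) ^ k * g1 x := by rw [← e1, hval]
      have e2' : (a 0) * deriv f0 x + a 1 * deriv f1 x = (x - w) ^ k * g2 x := by
        rw [← e2, hderiv]
      rw [hW]
      field_simp
      linear_combination (E x * f0 x) * e2' - (E x * deriv f0 x) * e1'

/-- The term `(l 1 - l 0) p₀ p₁` dominates the two containing a derivative. -/
theorem natDegree_wronskianPoly {l : Fin 2 → ℂ} (hl : l 0 ≠ l 1) {p : Fin 2 → ℂ[X]}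
    (hp : ∀ i, p i ≠ 0) :
    wronskianPoly l p ≠ 0 ∧
      (wronskianPoly l p).natDegree = (p 0).natDegree + (p 1).natDegree := by
  have hδ : l 1 - l 0 ≠ 0 := sub_ne_zero.2 hl.symm
  have h0 : (C (l 1 - l 0) * (p 0 * p 1)).degree = (p 0).degree + (p 1).degree := by
    rw [degree_mul, degree_C hδ, zero_add, degree_mul]
  have h1 : (p 0 * derivative (p 1)).degree < (p 0).degree + (p 1).degree := by
    rw [degree_mul]
    exact WithBot.add_lt_add_left (degree_ne_bot.2 (hp 0)) (degree_derivative_lt (hp 1))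
  have h2 : (derivative (p 0) * p 1).degree < (p 0).degree + (p 1).degree := by
    rw [degree_mul]
    exact WithBot.add_lt_add_right (degree_ne_bot.2 (hp 1)) (degree_derivative_lt (hp 0))
  have hdeg : (wronskianPoly l p).degree = (p 0).degree + (p 1).degree := by
    rw [wronskianPoly, add_sub_assoc, degree_add_eq_left_of_degree_lt, h0]
    rw [h0]
    exact (degree_sub_le _ _).trans_lt (max_lt h1 h2)
  have hne : wronskianPoly l p ≠ 0 := by
    rw [← degree_ne_bot, hdeg, ← degree_mul, degree_ne_bot]
    exact mul_ne_zero (hp 0) (hp 1)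
  refine ⟨hne, ?_⟩
  rw [degree_eq_natDegree hne, degree_eq_natDegree (hp 0), degree_eq_natDegree (hp 1)] at hdeg
  exact_mod_cast hdeg

theorem exists_wronskianPoly_eq {l z : Fin 2 → ℂ} {n m : Fin 2 → ℕ}
    (hnm : n 0 + n 1 = m 0 + m 1) {p : Fin 2 → ℂ[X]}
    (hp : ∀ i, (p i).degree = (n i : WithBot ℕ)) (hV : IsSpecialSpace l z n m (quasiSpace l p)) :
    ∃ K : ℂ, wronskianPoly l p = C K * ((X - C (z 0)) ^ m 0 * (X - C (z 1)) ^ m 1) := by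
  have hne : ∀ i, p i ≠ 0 := fun i h => by
    have := hp i
    rw [h, degree_zero] at this
    exact WithBot.bot_ne_coe this
  have hdvd : ∀ a, (X - C (z a)) ^ m a ∣ wronskianPoly l p := fun a =>
    pow_dvd_wronskianPoly (by rw [hV.exponents_z a]; simp [add_comm])
  have hcop : IsCoprime ((X - C (z 0)) ^ m 0) ((X - C (z 1)) ^ m 1) :=
    (isCoprime_X_sub_C_of_isUnit_sub
      (sub_ne_zero.2 (hV.z_injective.ne (by decide))).isUnit).pow
  obtain ⟨h, hh⟩ := hcop.mul_dvd (hdvd 0) (hdvd 1)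
  obtain ⟨hW0, hWdeg⟩ := natDegree_wronskianPoly (hV.l_injective.ne (by decide)) hne
  have hP : ((X - C (z 0)) ^ m 0 * (X - C (z 1)) ^ m 1 : ℂ[X]).Monic :=
    ((monic_X_sub_C _).pow _).mul ((monic_X_sub_C _).pow _)
  have hPdeg : ((X - C (z 0)) ^ m 0 * (X - C (z 1)) ^ m 1 : ℂ[X]).natDegree = m 0 + m 1 := by
    rw [((monic_X_sub_C _).pow _).natDegree_mul ((monic_X_sub_C _).pow _)]
    simp
  have h0 : h ≠ 0 := by rintro rfl; exact hW0 (by rw [hh, mul_zero])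
  have hdeg : h.natDegree = 0 := by
    have := hP.natDegree_mul' h0
    rw [← hh, hWdeg, hPdeg, natDegree_eq_of_degree_eq_some (hp 0),
      natDegree_eq_of_degree_eq_some (hp 1)] at this
    omega
  refine ⟨h.coeff 0, ?_⟩
  rw [hh, mul_comm]
  congr 1
  exact eq_C_of_natDegree_eq_zero hdeg

/-- At a common root every element of the space would vanish, yet `0` is an exponent at every point.
-/
theorem isCoprime_of_special {l z : Fin 2 → ℂ} {n m : Fin 2 → ℕ} {p : Fin 2 → ℂ[X]}
    (hV : IsSpecialSpace l z n m (quasiSpace l p)) : IsCoprime (p 0) (p 1) := by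
  rw [Polynomial.isCoprime_iff_aeval_ne_zero_of_isAlgClosed ℂ ℂ]
  intro x
  by_contra! hx
  have h0 : 0 ∈ exponents (quasiSpace l p) x := by
    by_cases hxz : x ∈ Set.range z
    · obtain ⟨a, rfl⟩ := hxz
      rw [hV.exponents_z a]; simp
    · rw [hV.exponents_regular x hxz]; simp
  obtain ⟨f, hf, hord⟩ := h0
  obtain ⟨a, rfl⟩ := mem_quasiSpace_iff.1 hf
  have han : AnalyticAt ℂ (a 0 • quasiPoly (p 0) (l 0) + a 1 • quasiPoly (p 1) (l 1)) x :=
    (((differentiable_quasiPoly _ _).const_smul _).add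
      ((differentiable_quasiPoly _ _).const_smul _)).analyticAt x
  rw [Nat.cast_zero, han.analyticOrderAt_eq_zero] at hord
  apply hord
  simp only [coe_aeval_eq_eval] at hx
  simp [quasiPoly, hx.1, hx.2]

/-! ### The differential equations -/

theorem mul_derivative_X_sub_C_pow_mul (a b : ℂ) (s i : ℕ) :
    (X - C a) * (X - C b) * derivative ((X - C a) ^ s * (X - C b) ^ i : ℂ[X]) =
      (C (s : ℂ) * (X - C b) + C (i : ℂ) * (X - C a)) * ((X - C a) ^ s * (X - C b) ^ i) := by
  rw [mul_right_comm, X_sub_C_mul_derivative]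
  cases i with
  | zero => simp; ring
  | succ i => simp only [Nat.add_sub_cancel]; ring

/-- The Wronskian `W` satisfies `S W' = T W` with `S = (x - z 0)(x - z 1)`. Expanded, this links the
Heun operators of `p 0` and `p 1`. -/
theorem exists_solvesHeun {l z : Fin 2 → ℂ} {n m : Fin 2 → ℕ}
    (hnm : n 0 + n 1 = m 0 + m 1) {p : Fin 2 → ℂ[X]}
    (hp : ∀ i, (p i).degree = (n i : WithBot ℕ)) (hV : IsSpecialSpace l z n m (quasiSpace l p)) :
    ∃ E : ℂ, SolvesHeun z m (l 1 - l 0) (n 1) E (p 1) ∧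
      SolvesHeun z m (l 0 - l 1) (n 0) (E - (l 1 - l 0) * m 1 * (z 1 - z 0)) (p 0) := by
  obtain ⟨K, hK⟩ := exists_wronskianPoly_eq hnm hp hV
  have hcop := isCoprime_of_special hV
  set δ := l 1 - l 0 with hδ
  have hδ' : l 0 - l 1 = -δ := by rw [hδ]; ring
  set T : ℂ[X] := C (m 0 : ℂ) * (X - C (z 1)) + C (m 1 : ℂ) * (X - C (z 0)) with hT
  have hW : (X - C (z 0)) * (X - C (z 1)) * derivative (wronskianPoly l p) =
      T * wronskianPoly l p := by
    rw [hK, derivative_C_mul]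
    linear_combination C K * mul_derivative_X_sub_C_pow_mul (z 0) (z 1) (m 0) (m 1)
  have key : p 0 * heunOp z m δ (p 1) - p 1 * heunOp z m (-δ) (p 0) =
      C δ * T * (p 0 * p 1) := by
    rw [heunOp_apply, heunOp_apply, ← hT, C_neg]
    rw [wronskianPoly, ← hδ] at hW
    simp only [derivative_add, derivative_sub, derivative_mul, derivative_C] at hW
    linear_combination hW
  have hp1 : p 1 ≠ 0 := fun h => by
    have := hp 1
    rw [h, degree_zero] at this
    exact WithBot.bot_ne_coe this
  have hdeg : (p 1).natDegree = n 1 := natDegree_eq_of_degree_eq_some (hp 1)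
  -- Coprimality separates the two equations. The quotient has degree at most one and slope `δ n₁`
  -- by the top coefficient; its value at `z 1` is the accessory parameter `E`.
  have hdvd : p 1 ∣ heunOp z m δ (p 1) := by
    refine hcop.symm.dvd_of_dvd_mul_left ⟨heunOp z m (-δ) (p 0) + C δ * T * p 0, ?_⟩
    linear_combination key
  obtain ⟨h, hh⟩ := hdvd
  have hhdeg : h.natDegree ≤ 1 := by
    rcases eq_or_ne h 0 with rfl | h0
    · simp
    · have h1 := natDegree_heunOp_le (y := z) (M := m) (δ := δ) (p := p 1) le_rfl
      rw [hh, natDegree_mul hp1 h0] at h1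
      omega
  have hlin : h = C (h.coeff 1) * X + C (h.coeff 0) := eq_X_add_C_of_natDegree_le_one hhdeg
  have htop : h.coeff 1 = δ * n 1 := by
    have h1 := coeff_heunOp_top (y := z) (M := m) (δ := δ) (p := p 1) hdeg.le
    rw [hh, coeff_mul_add_eq_of_natDegree_le hdeg.le hhdeg] at h1
    have hlc : (p 1).coeff (n 1) ≠ 0 := by rw [← hdeg]; simpa using hp1
    exact mul_left_cancel₀ hlc (by linear_combination h1)
  have hform : h = C (δ * n 1) * (X - C (z 1)) + C (h.coeff 0 + δ * n 1 * z 1) := by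
    conv_lhs => rw [hlin, htop]
    simp only [map_add, map_mul]
    ring
  generalize h.coeff 0 = e at hform
  refine ⟨e + δ * n 1 * z 1, ?_, ?_⟩
  · rw [SolvesHeun, ← hform, hh, mul_comm]
  · rw [hδ', SolvesHeun]
    have h1 : heunOp z m (-δ) (p 0) = (h - C δ * T) * p 0 := by
      refine mul_left_cancel₀ hp1 ?_
      linear_combination p 0 * hh - key
    have hn : (n 0 : ℂ) = m 0 + m 1 - n 1 := by
      rw [eq_sub_iff_add_eq]; exact_mod_cast hnm
    rw [h1, hform, hT, hn]
    simp only [map_add, map_sub, map_mul, map_neg]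
    ring

/-! ### The dual space -/

/-- The polynomial `lin` in the equation `S f'' - (σ S + T) f' + (l₁ l₂ S + lin) f = 0`, where
`σ = l₁ + l₂`, of the functions of a special space. -/
noncomputable def linPart (l z : Fin 2 → ℂ) (n m : Fin 2 → ℕ) (E x : ℂ) : ℂ :=
  l 1 * (m 0 * (x - z 1) + m 1 * (x - z 0)) - ((l 1 - l 0) * n 1 * (x - z 1) + E)

/-- Restoring the factors `exp (l i x)` merges the two Heun equations into a single linear equation
valid on the whole space. -/
theorem exists_hasDerivAt_of_mem {l z : Fin 2 → ℂ} {n m : Fin 2 → ℕ}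
    (hnm : n 0 + n 1 = m 0 + m 1) {p : Fin 2 → ℂ[X]} {E : ℂ}
    (h₁ : SolvesHeun z m (l 1 - l 0) (n 1) E (p 1))
    (h₀ : SolvesHeun z m (l 0 - l 1) (n 0) (E - (l 1 - l 0) * m 1 * (z 1 - z 0)) (p 0))
    {f : ℂ → ℂ} (hf : f ∈ quasiSpace l p) :
    ∃ f' f'' : ℂ → ℂ, (∀ x, HasDerivAt f (f' x) x) ∧ (∀ x, HasDerivAt f' (f'' x) x) ∧
      ∀ x, (x - z 0) * (x - z 1) * f'' x - ((l 0 + l 1) * ((x - z 0) * (x - z 1)) +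
        (m 0 * (x - z 1) + m 1 * (x - z 0))) * f' x +
        (l 0 * l 1 * ((x - z 0) * (x - z 1)) + linPart l z n m E x) * f x = 0 := by
  have hn : (n 0 : ℂ) = m 0 + m 1 - n 1 := by
    rw [eq_sub_iff_add_eq]; exact_mod_cast hnm
  obtain ⟨a, rfl⟩ := mem_quasiSpace_iff.1 hf
  set p0' := derivative (p 0) + C (l 0) * p 0 with hp0'
  set p1' := derivative (p 1) + C (l 1) * p 1 with hp1'
  refine ⟨a 0 • quasiPoly p0' (l 0) + a 1 • quasiPoly p1' (l 1),
    a 0 • quasiPoly (derivative p0' + C (l 0) * p0') (l 0) +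
      a 1 • quasiPoly (derivative p1' + C (l 1) * p1') (l 1), fun x => ?_, fun x => ?_, fun x => ?_⟩
  · exact ((hasDerivAt_quasiPoly _ _ x).const_smul _).add
      ((hasDerivAt_quasiPoly _ _ x).const_smul _)
  · exact ((hasDerivAt_quasiPoly _ _ x).const_smul _).add
      ((hasDerivAt_quasiPoly _ _ x).const_smul _)
  · have e0 := congrArg (eval x) h₀
    have e1 := congrArg (eval x) h₁
    rw [heunOp_apply] at e0 e1
    simp only [eval_add, eval_sub, eval_mul, eval_C, eval_X] at e0 e1
    rw [hn] at e0
    simp only [hp0', hp1', Pi.add_apply, Pi.smul_apply, smul_eq_mul, quasiPoly, derivative_add,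
      derivative_C_mul, eval_add, eval_mul, eval_C, linPart]
    linear_combination (a 0 * Complex.exp (l 0 * x)) * e0 + (a 1 * Complex.exp (l 1 * x)) * e1

/-- For dimension two the numerator is a 1×1 Wronskian, that is, an element of the space, and
changing basis only multiplies the denominator by a determinant. -/
theorem exists_eq_div_of_mem_conjugateSpace {l z : Fin 2 → ℂ} {m : Fin 2 → ℕ} {p : Fin 2 → ℂ[X]}
    {K : ℂ} (hK : wronskianPoly l p = C K * ((X - C (z 0)) ^ m 0 * (X - C (z 1)) ^ m 1))
    {g : ℂ → ℂ} (hg : g ∈ conjugateSpace 2 (quasiSpace l p)) :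
    ∃ f ∈ quasiSpace l p, ∀ x, g x =
      f x / ((x - z 0) ^ m 0 * (x - z 1) ^ m 1 * Complex.exp ((l 0 + l 1) * x)) := by
  induction hg using Submodule.span_induction with
  | zero => exact ⟨0, Submodule.zero_mem _, fun x => by simp⟩
  | add g g' _ _ h h' =>
    obtain ⟨f, hf, e⟩ := h
    obtain ⟨f', hf', e'⟩ := h'
    exact ⟨f + f', Submodule.add_mem _ hf hf', fun x => by
      rw [Pi.add_apply, Pi.add_apply, e, e', add_div]⟩
  | smul a g _ h =>
    obtain ⟨f, hf, e⟩ := h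
    exact ⟨a • f, Submodule.smul_mem _ _ hf, fun x => by
      rw [Pi.smul_apply, Pi.smul_apply, e, smul_eq_mul, smul_eq_mul, mul_div_assoc]⟩
  | mem g hg =>
    obtain ⟨b, -, hspan, f, hf, rfl⟩ := hg
    have hb : ∀ i, b i ∈ quasiSpace l p := fun i => hspan ▸ Submodule.subset_span ⟨i, rfl⟩
    have hb' := fun i => mem_quasiSpace_iff.1 (hb i)
    choose A hA using hb'
    have hder : ∀ i x, deriv (b i) x = A i 0 * deriv (quasiPoly (p 0) (l 0)) x +
        A i 1 * deriv (quasiPoly (p 1) (l 1)) x := fun i x => by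
      rw [hA i, deriv_add ((differentiable_quasiPoly _ _).const_smul _ x)
        ((differentiable_quasiPoly _ _).const_smul _ x),
        deriv_const_smul _ (differentiable_quasiPoly _ _ x),
        deriv_const_smul _ (differentiable_quasiPoly _ _ x)]
      rfl
    have hval : ∀ i x, b i x = A i 0 * quasiPoly (p 0) (l 0) x +
        A i 1 * quasiPoly (p 1) (l 1) x := fun i x => by rw [hA i]; rfl
    have hWb : ∀ x, functionWronskian b x = (A 0 0 * A 1 1 - A 0 1 * A 1 0) * K *
        ((x - z 0) ^ m 0 * (x - z 1) ^ m 1 * Complex.exp ((l 0 + l 1) * x)) := by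
      intro x
      have h := quasiPoly_wronskian l p x
      rw [hK] at h
      simp only [eval_mul, eval_C, eval_pow, eval_sub, eval_X] at h
      rw [functionWronskian, Matrix.det_fin_two]
      simp only [Matrix.of_apply, Fin.val_zero, Fin.val_one, iteratedDeriv_zero, iteratedDeriv_one,
        hder, hval]
      linear_combination (A 0 0 * A 1 1 - A 0 1 * A 1 0) * h
    have hWf : ∀ x, functionWronskian f x = f 0 x := by
      intro x
      have : functionWronskian f x = (Matrix.of fun i j : Fin 1 =>
        iteratedDeriv (j : ℕ) (f i) x).det := rfl
      rw [this, Matrix.det_fin_one]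
      simp
    -- Since `x / 0 = 0` and `0⁻¹ = 0`, the identity covers a zero scalar as well.
    refine ⟨((A 0 0 * A 1 1 - A 0 1 * A 1 0) * K)⁻¹ • f 0, Submodule.smul_mem _ _ (hf 0),
      fun x => ?_⟩
    simp only [hWb, hWf, Pi.smul_apply, smul_eq_mul]
    rw [← div_div]
    ring

/-- Differentiation under the integral; the dominating constant comes from compactness of the
parameter interval times a closed unit ball around `u`. -/
theorem hasDerivAt_circleIntegral_exp_mul {φ : ℂ → ℂ} {c : ℂ} {r : ℝ} (hr : 0 ≤ r)
    (hφ : ContinuousOn φ (Metric.sphere c r)) (u : ℂ) :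
    HasDerivAt (fun u => ∮ x in C(c, r), Complex.exp (u * x) * φ x)
      (∮ x in C(c, r), Complex.exp (u * x) * (x * φ x)) u := by
  have hcm : Continuous (fun θ : ℝ => φ (circleMap c r θ)) :=
    hφ.comp_continuous (continuous_circleMap c r) fun θ => circleMap_mem_sphere c hr θ
  have hd : Continuous (fun θ : ℝ => deriv (circleMap c r) θ) := by
    simp only [deriv_circleMap]
    exact (continuous_circleMap 0 r).mul continuous_const
  simp only [circleIntegral]
  obtain ⟨B, hB⟩ : ∃ B : ℝ, ∀ θ ∈ Set.uIcc (0 : ℝ) (2 * Real.pi), ∀ v ∈ Metric.closedBall u 1,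
      ‖deriv (circleMap c r) θ • (Complex.exp (v * circleMap c r θ) *
        (circleMap c r θ * φ (circleMap c r θ)))‖ ≤ B := by
    have hc : Continuous (fun q : ℝ × ℂ => deriv (circleMap c r) q.1 •
        (Complex.exp (q.2 * circleMap c r q.1) *
          (circleMap c r q.1 * φ (circleMap c r q.1)))) := by
      have h1 := hd.comp (continuous_fst (X := ℝ) (Y := ℂ))
      have h2 := hcm.comp (continuous_fst (X := ℝ) (Y := ℂ))
      have h3 := (continuous_circleMap c r).comp (continuous_fst (X := ℝ) (Y := ℂ))
      exact h1.smul ((Complex.continuous_exp.comp (continuous_snd.mul h3)).mul (h3.mul h2))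
    obtain ⟨B, hB⟩ := (isCompact_uIcc.prod (isCompact_closedBall u 1)).exists_bound_of_continuousOn
      hc.continuousOn
    exact ⟨B, fun θ hθ v hv => hB (θ, v) ⟨hθ, hv⟩⟩
  have hcont : ∀ v : ℂ, Continuous (fun θ : ℝ => deriv (circleMap c r) θ •
      (Complex.exp (v * circleMap c r θ) * φ (circleMap c r θ))) := fun v =>
    hd.smul ((Complex.continuous_exp.comp (continuous_const.mul (continuous_circleMap c r))).mul
      hcm)
  have hcont' : Continuous (fun θ : ℝ => deriv (circleMap c r) θ •
      (Complex.exp (u * circleMap c r θ) * (circleMap c r θ * φ (circleMap c r θ)))) :=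
    hd.smul ((Complex.continuous_exp.comp (continuous_const.mul (continuous_circleMap c r))).mul
      ((continuous_circleMap c r).mul hcm))
  refine (intervalIntegral.hasDerivAt_integral_of_dominated_loc_of_deriv_le
    (F := fun (v : ℂ) (θ : ℝ) => deriv (circleMap c r) θ •
      (Complex.exp (v * circleMap c r θ) * φ (circleMap c r θ)))
    (F' := fun (v : ℂ) (θ : ℝ) => deriv (circleMap c r) θ •
      (Complex.exp (v * circleMap c r θ) * (circleMap c r θ * φ (circleMap c r θ))))
    (bound := fun _ => B) (Metric.closedBall_mem_nhds u one_pos) ?_ ?_ ?_ ?_ ?_ ?_).2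
  · exact Filter.Eventually.of_forall fun v => (hcont v).aestronglyMeasurable
  · exact (hcont u).intervalIntegrable _ _
  · exact hcont'.aestronglyMeasurable
  · exact Filter.Eventually.of_forall fun θ hθ v hv => hB θ (Set.uIoc_subset_uIcc hθ) v hv
  · exact intervalIntegrable_const
  · refine Filter.Eventually.of_forall fun θ _ v _ => ?_
    simp only [smul_eq_mul]
    refine HasDerivAt.const_mul _ ?_
    have := (((hasDerivAt_id v).mul_const (circleMap c r θ)).cexp).mul_const
      (φ (circleMap c r θ))
    refine this.congr_deriv ?_
    simp only [id]
    ring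

/-- The bispectral dual differential equation. -/
def SolvesDual (l z : Fin 2 → ℂ) (n m : Fin 2 → ℕ) (E : ℂ) (g : ℂ → ℂ) : Prop :=
  ∃ g' g'' : ℂ → ℂ, (∀ u, HasDerivAt g (g' u) u) ∧ (∀ u, HasDerivAt g' (g'' u) u) ∧
    ∀ u, (u - l 0) * (u - l 1) * (g'' u - (z 0 + z 1) * g' u + z 0 * z 1 * g u) -
      (u - l 1) * ((m 0 + m 1) * g' u - (m 0 * z 1 + m 1 * z 0) * g u) -
      ((l 1 - l 0) * n 1 * (g' u - z 1 * g u) + E * g u) = 0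

/-- Under the integral `d/du` becomes multiplication by `x`, so the dual operator yields a quadratic
in `x` times the integrand; the equation for `f` shows that this is an exact derivative. -/
theorem solvesDual_circleIntegral {l z : Fin 2 → ℂ} {n m : Fin 2 → ℕ} {E : ℂ} {f : ℂ → ℂ}
    (hf : ∃ f' f'' : ℂ → ℂ, (∀ x, HasDerivAt f (f' x) x) ∧ (∀ x, HasDerivAt f' (f'' x) x) ∧
      ∀ x, (x - z 0) * (x - z 1) * f'' x - ((l 0 + l 1) * ((x - z 0) * (x - z 1)) +
        (m 0 * (x - z 1) + m 1 * (x - z 0))) * f' x +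
        (l 0 * l 1 * ((x - z 0) * (x - z 1)) + linPart l z n m E x) * f x = 0)
    {c : ℂ} {r : ℝ} (hr : 0 ≤ r) (hz : ∀ x ∈ Metric.sphere c r, ∀ a, x ≠ z a) :
    SolvesDual l z n m E (fun u => ∮ x in C(c, r), Complex.exp (u * x) *
      (f x / ((x - z 0) ^ m 0 * (x - z 1) ^ m 1 * Complex.exp ((l 0 + l 1) * x)) *
        ((x - z 0)⁻¹ * (x - z 1)⁻¹))) := by
  obtain ⟨f', f'', hf', hf'', hode⟩ := hf
  set φ : ℂ → ℂ := fun x =>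
    f x / ((x - z 0) ^ m 0 * (x - z 1) ^ m 1 * Complex.exp ((l 0 + l 1) * x)) *
        ((x - z 0)⁻¹ * (x - z 1)⁻¹) with hφ
  have hsub : ∀ x ∈ Metric.sphere c r, ∀ a, x - z a ≠ 0 := fun x hx a => sub_ne_zero.2 (hz x hx a)
  have hcφ : ContinuousOn φ (Metric.sphere c r) := by
    have hcf : Continuous f := continuous_iff_continuousAt.2 fun x => (hf' x).continuousAt
    refine ContinuousOn.mul (hcf.continuousOn.div (by fun_prop) fun x hx => ?_)
      (ContinuousOn.mul (ContinuousOn.inv₀ (by fun_prop) fun x hx => hsub x hx 0)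
        (ContinuousOn.inv₀ (by fun_prop) fun x hx => hsub x hx 1))
    exact mul_ne_zero (mul_ne_zero (pow_ne_zero _ (hsub x hx 0)) (pow_ne_zero _ (hsub x hx 1)))
      (Complex.exp_ne_zero _)
  have hcφ' : ContinuousOn (fun x => x * φ x) (Metric.sphere c r) := continuousOn_id.mul hcφ
  refine ⟨_, _, fun u => hasDerivAt_circleIntegral_exp_mul hr hcφ u,
    fun u => hasDerivAt_circleIntegral_exp_mul hr hcφ' u, fun u => ?_⟩
  have hexp : Continuous (fun x : ℂ => Complex.exp (u * x)) := by fun_prop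
  have i0 : CircleIntegrable (fun x => Complex.exp (u * x) * φ x) c r :=
    (hexp.continuousOn.mul hcφ).circleIntegrable hr
  have i1 : CircleIntegrable (fun x => Complex.exp (u * x) * (x * φ x)) c r :=
    (hexp.continuousOn.mul hcφ').circleIntegrable hr
  have i2 : CircleIntegrable (fun x => Complex.exp (u * x) * (x * (x * φ x))) c r :=
    (hexp.continuousOn.mul (continuousOn_id.mul hcφ')).circleIntegrable hr
  set a2 := (u - l 0) * (u - l 1) with ha2
  set a1 := -(a2 * (z 0 + z 1)) - (u - l 1) * (m 0 + m 1) - (l 1 - l 0) * n 1 with ha1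
  set a0 := a2 * (z 0 * z 1) + (u - l 1) * (m 0 * z 1 + m 1 * z 0) + (l 1 - l 0) * n 1 * z 1 - E
    with ha0
  have hsum : (∮ x in C(c, r), (a2 * (Complex.exp (u * x) * (x * (x * φ x))) +
      a1 * (Complex.exp (u * x) * (x * φ x)) + a0 * (Complex.exp (u * x) * φ x))) = 0 := by
    -- The primitive is `-exp (u x) (f' - u f) / D`, where `D` is the denominator of the conjugate
    -- function; it is what integration by parts of the `f''` and `f'` terms leaves.
    refine circleIntegral.integral_eq_zero_of_hasDerivWithinAt (f := fun x =>
      -(Complex.exp (u * x) * (f' x - u * f x) /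
        ((x - z 0) ^ m 0 * (x - z 1) ^ m 1 * Complex.exp ((l 0 + l 1) * x)))) hr fun x hx => ?_
    apply HasDerivAt.hasDerivWithinAt
    have hx0 := hsub x hx 0
    have hx1 := hsub x hx 1
    have he := Complex.exp_ne_zero ((l 0 + l 1) * x)
    set P : ℂ[X] := (X - C (z 0)) ^ m 0 * (X - C (z 1)) ^ m 1 with hP
    have hPev : ∀ y, P.eval y = (y - z 0) ^ m 0 * (y - z 1) ^ m 1 := fun y => by simp [hP]
    have hPne : P.eval x ≠ 0 := by
      rw [hPev]; exact mul_ne_zero (pow_ne_zero _ hx0) (pow_ne_zero _ hx1)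
    have hPder : (derivative P).eval x =
        (m 0 * (x - z 1) + m 1 * (x - z 0)) / ((x - z 0) * (x - z 1)) * P.eval x := by
      have := congrArg (eval x) (mul_derivative_X_sub_C_pow_mul (z 0) (z 1) (m 0) (m 1))
      rw [← hP] at this
      simp only [eval_mul, eval_add, eval_sub, eval_X, eval_C] at this
      field_simp
      linear_combination this
    have de : ∀ μ : ℂ, HasDerivAt (fun x : ℂ => Complex.exp (μ * x))
        (Complex.exp (μ * x) * (μ * 1)) x := fun μ => ((hasDerivAt_id x).const_mul μ).cexp
    simp only [← hPev]
    have hder := (((de u).mul ((hf'' x).sub ((hf' x).const_mul u))).div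
      ((P.hasDerivAt x).mul (de (l 0 + l 1))) (mul_ne_zero hPne he)).neg
    refine hder.congr_deriv ?_
    have hode' : f'' x = ((l 0 + l 1) + (m 0 * (x - z 1) + m 1 * (x - z 0)) /
        ((x - z 0) * (x - z 1))) * f' x - (l 0 * l 1 + linPart l z n m E x /
        ((x - z 0) * (x - z 1))) * f x := by
      field_simp
      linear_combination hode x
    simp only [Pi.mul_apply, Pi.sub_apply, hPder, hφ, ← hPev]
    rw [hode']
    simp only [linPart, ha0, ha1, ha2]
    field_simp
    ring
  rw [circleIntegral.integral_add ?_ ?_, circleIntegral.integral_add ?_ ?_] at hsum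
  · simp only [circleIntegral.integral_const_mul] at hsum
    rw [ha0, ha1] at hsum
    linear_combination hsum
  · exact i2.const_mul _
  · exact i1.const_mul _
  · exact (i2.const_mul _).add (i1.const_mul _)
  · exact i0.const_mul _

theorem solvesDual_of_mem_specialDual {l z : Fin 2 → ℂ} (hzinj : z 0 ≠ z 1) {n m : Fin 2 → ℕ}
    (hnm : n 0 + n 1 = m 0 + m 1) {p : Fin 2 → ℂ[X]} {E K : ℂ}
    (hK : wronskianPoly l p = C K * ((X - C (z 0)) ^ m 0 * (X - C (z 1)) ^ m 1))
    (h₁ : SolvesHeun z m (l 1 - l 0) (n 1) E (p 1))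
    (h₀ : SolvesHeun z m (l 0 - l 1) (n 0) (E - (l 1 - l 0) * m 1 * (z 1 - z 0)) (p 0))
    {g : ℂ → ℂ} (hg : g ∈ specialDual 2 z (quasiSpace l p)) : SolvesDual l z n m E g := by
  induction hg using Submodule.span_induction with
  | zero =>
    exact ⟨0, 0, fun u => hasDerivAt_const u 0, fun u => hasDerivAt_const u 0, fun u => by simp⟩
  | add g₁ g₂ _ _ h h' =>
    obtain ⟨a', a'', h1, h2, h3⟩ := h
    obtain ⟨b', b'', k1, k2, k3⟩ := h'
    refine ⟨a' + b', a'' + b'', fun u => (h1 u).add (k1 u), fun u => (h2 u).add (k2 u),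
      fun u => ?_⟩
    simp only [Pi.add_apply]
    linear_combination h3 u + k3 u
  | smul a g _ h =>
    obtain ⟨a', a'', h1, h2, h3⟩ := h
    refine ⟨a • a', a • a'', fun u => (h1 u).const_smul a, fun u => (h2 u).const_smul a,
      fun u => ?_⟩
    simp only [Pi.smul_apply, smul_eq_mul]
    linear_combination a * h3 u
  | mem g hg =>
    obtain ⟨a, ψ, hψ, hev⟩ := hg
    obtain ⟨f, hf, hψf⟩ := exists_eq_div_of_mem_conjugateSpace hK hψ
    have hd : 0 < dist (z 0) (z 1) := dist_pos.2 hzinj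
    have hsmall : ∀ᶠ r : ℝ in nhdsWithin 0 (Set.Ioi 0), r ∈ Set.Ioo 0 (dist (z 0) (z 1)) :=
      Ioo_mem_nhdsGT hd
    -- A radius for which the integral formula holds and whose circle misses both `z 0` and `z 1`.
    obtain ⟨r, hr, hr0, hrd⟩ := (hev.and hsmall).exists
    have hz : ∀ x ∈ Metric.sphere (z a) r, ∀ b, x ≠ z b := by
      rintro x hx b rfl
      rw [Metric.mem_sphere] at hx
      rcases eq_or_ne b a with rfl | hab
      · rw [dist_self] at hx; exact hr0.ne hx
      · have : dist (z b) (z a) = dist (z 0) (z 1) := by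
          fin_cases a <;> fin_cases b <;> simp_all [dist_comm]
        rw [this] at hx
        exact hrd.ne' hx
    have := solvesDual_circleIntegral (exists_hasDerivAt_of_mem hnm h₁ h₀ hf) hr0.le hz
    convert this using 1
    funext u
    rw [hr u]
    congr 1
    funext x
    rw [hψf, Fin.prod_univ_two, mul_assoc]

/-- Cancelling `exp (z 1 * u)` leaves a Heun equation with the two sets of data exchanged; `E` is
preserved thanks to `hnm`. -/
theorem solvesHeun_of_solvesDual {l z : Fin 2 → ℂ} {n m : Fin 2 → ℕ}
    (hnm : n 0 + n 1 = m 0 + m 1) {q : ℂ[X]} {E : ℂ}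
    (h : SolvesDual l z n m E (quasiPoly q (z 1))) : SolvesHeun l n (z 1 - z 0) (m 1) E q := by
  obtain ⟨g', g'', h1, h2, h3⟩ := h
  obtain rfl : g' = quasiPoly (derivative q + C (z 1) * q) (z 1) :=
    funext fun u => (h1 u).unique (hasDerivAt_quasiPoly _ _ u)
  obtain rfl : g'' = _ := funext fun u => (h2 u).unique (hasDerivAt_quasiPoly _ _ u)
  have hn : (n 0 : ℂ) = m 0 + m 1 - n 1 := by
    rw [eq_sub_iff_add_eq]; exact_mod_cast hnm
  refine Polynomial.funext fun u => ?_
  have h4 := h3 u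
  simp only [quasiPoly, derivative_add, derivative_C_mul, eval_add, eval_mul, eval_C] at h4
  refine mul_right_cancel₀ (Complex.exp_ne_zero (z 1 * u)) ?_
  rw [heunOp_apply]
  simp only [eval_add, eval_sub, eval_mul, eval_C, eval_X, hn]
  linear_combination h4

/-! ### Solutions of the recurrence on the central block -/

theorem heunRec_sub_smul (M : Fin 2 → ℕ) (ε : ℂ) (k : ℕ) (E a b : ℂ) (c x : ℕ → ℂ) (i : ℕ) :
    heunRec M ε k E (fun j => a * c j - b * x j) i =
      a * heunRec M ε k E c i - b * heunRec M ε k E x i := by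
  simp only [heunRec]
  ring

/-- Forward propagation. At the start of the block the coefficient of `c (i - 1)` is zero, since `i
= 0` or `i = k - M 0`; before the end, the coefficient `(k - i)(i - M 1)` of `c (i + 1)` is nonzero.
-/
theorem eq_zero_of_heunRec {M : Fin 2 → ℕ} {ε : ℂ} {k : ℕ} {E : ℂ} {c : ℕ → ℂ}
    (hc : ∀ i, k - M 0 ≤ i → i < min (M 1) k → heunRec M ε k E c i = 0) (h0 : c (k - M 0) = 0) :
    ∀ i ∈ Finset.Icc (k - M 0) (min (M 1) k), c i = 0 := by
  intro i
  induction i using Nat.strong_induction_on with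
  | _ i ih =>
    intro hi
    rw [Finset.mem_Icc] at hi
    rcases eq_or_lt_of_le hi.1 with h | h
    · rw [← h, h0]
    obtain ⟨j, rfl⟩ : ∃ j, i = j + 1 := ⟨i - 1, by omega⟩
    have hj : c j = 0 := ih j (by omega) (Finset.mem_Icc.2 ⟨by omega, by omega⟩)
    have hrec := hc j (by omega) (by omega)
    have hprev : (j : ℂ) * (k - j - M 0) * c (j - 1) = 0 := by
      rcases eq_or_lt_of_le (show k - M 0 ≤ j by omega) with h' | h'
      · rcases le_total k (M 0) with hk | hk
        · simp [show j = 0 by omega]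
        · have : (j : ℂ) = k - M 0 := by rw [← h', Nat.cast_sub hk]
          rw [this]; ring
      · rw [ih (j - 1) (by omega) (Finset.mem_Icc.2 ⟨by omega, by omega⟩), mul_zero]
    rw [heunRec, hprev, hj] at hrec
    have h1 : (k : ℂ) - j ≠ 0 := sub_ne_zero.2 (by exact_mod_cast (show k ≠ j by omega))
    have h2 : (j : ℂ) - M 1 ≠ 0 := sub_ne_zero.2 (by exact_mod_cast (show j ≠ M 1 by omega))
    have h3 : ((k : ℂ) - j) * (j - M 1) * c (j + 1) = 0 := by linear_combination hrec
    exact (mul_eq_zero.1 h3).resolve_left (mul_ne_zero h1 h2)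

theorem exists_common_solution {M : Fin 2 → ℕ} {ε : ℂ} {k : ℕ} {E : ℂ} (S : Set (ℕ → ℂ))
    (hS : ∀ c ∈ S, ∀ i, k - M 0 ≤ i → i < min (M 1) k → heunRec M ε k E c i = 0) :
    ∃ x : ℕ → ℂ, x (k - M 0) = 1 ∧
      ∀ c ∈ S, ∀ i ∈ Finset.Icc (k - M 0) (min (M 1) k), c i = c (k - M 0) * x i := by
  by_cases h : ∃ c ∈ S, c (k - M 0) ≠ 0
  · obtain ⟨y, hy, hy0⟩ := h
    refine ⟨fun i => y i / y (k - M 0), div_self hy0, fun c hc i hi => ?_⟩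
    have := eq_zero_of_heunRec (M := M) (ε := ε) (E := E)
      (c := fun j => y (k - M 0) * c j - c (k - M 0) * y j)
      (fun i h1 h2 => by rw [heunRec_sub_smul, hS c hc i h1 h2, hS y hy i h1 h2]; ring)
      (by ring) i hi
    field_simp
    linear_combination this
  · push Not at h
    -- Here all sequences vanish on the block, so any `x` normalized at the start will do.
    refine ⟨fun _ => 1, rfl, fun c hc i hi => ?_⟩
    rw [eq_zero_of_heunRec (hS c hc) (h c hc) i hi, h c hc, zero_mul]

/-- The Weyl symmetry of the recurrence. With `ε = (l 1 - l 0)(z 1 - z 0)` the shift of `E` is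
exactly that in the equation for `p 0`. -/
theorem heunRec_reverse {m n : Fin 2 → ℕ} (hnm : n 0 + n 1 = m 0 + m 1) (ε E : ℂ) (d : ℕ → ℂ)
    {i : ℕ} (hi : i ≤ m 1) : heunRec m ε (n 1) E (fun j => d (m 1 - j)) i =
      heunRec m (-ε) (n 0) (E - ε * m 1) d (m 1 - i) := by
  have hn : (n 0 : ℂ) = m 0 + m 1 - n 1 := by
    rw [eq_sub_iff_add_eq]; exact_mod_cast hnm
  simp only [heunRec, Nat.cast_sub hi, hn]
  rw [show m 1 - (i + 1) = m 1 - i - 1 by omega]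
  cases i with
  | zero => simp; ring
  | succ i =>
    rw [show m 1 - (i + 1 - 1) = m 1 - (i + 1) + 1 by omega]
    push_cast
    ring

/-- Both off-diagonal coefficients depend only on differences fixed by `hnm`, and `ε` is symmetric
in `l` and `z`, so duality leaves coefficient sequences as they are. -/
theorem heunRec_dual {m n : Fin 2 → ℕ} (hnm : n 0 + n 1 = m 0 + m 1) (ε E : ℂ) (e : ℕ → ℂ)
    (i : ℕ) : heunRec n ε (m 1) E e i = heunRec m ε (n 1) E e i := by
  have hn : (n 0 : ℂ) = m 0 + m 1 - n 1 := by
    rw [eq_sub_iff_add_eq]; exact_mod_cast hnm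
  simp only [heunRec, hn]
  ring

/-- Admissible roots of a polynomial solution of the confluent Heun equation form a critical point
of the master function, and the Bethe vector is given by the coefficients of the solution. -/
theorem bethe_of_solvesHeun {l y : Fin 2 → ℂ} (hl : l 0 ≠ l 1) (hy : y 0 ≠ y 1) {M : Fin 2 → ℕ}
    {k : ℕ} {E : ℂ} {p : ℂ[X]} {c : ℕ → ℂ} (hp : SolvesHeun y M (l 1 - l 0) k E p)
    (hdeg : p.degree = (k : WithBot ℕ)) (hk : k ≤ M 0 + M 1) (hc : p = twoPointPoly y k c)
    {t : Fin k → ℂ} (hpt : Represents p t) (ht : IsAdmissible y t) :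
    IsCriticalPoint l y M t ∧ universalVector y M t ≠ 0 ∧
      ∃ κ : ℂ, κ ≠ 0 ∧ universalVector y M t = κ • betheSum M k (fun i => (-1) ^ i * c i) := by
  refine ⟨isCriticalPoint_of_solvesHeun hp hpt ht, ?_⟩
  have hev : ∀ a, p.eval (y a) ≠ 0 := by
    obtain ⟨a, ha, hpa⟩ := hpt
    intro b
    rw [hpa, eval_mul, eval_C, eval_prod]
    refine mul_ne_zero ha (Finset.prod_ne_zero_iff.2 fun j _ => ?_)
    rw [eval_sub, eval_X, eval_C]
    exact sub_ne_zero.2 (ht.2 j b).symm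
  subst hc
  obtain ⟨i, hi, hci⟩ := hp.exists_coeff_ne_zero hy (sub_ne_zero.2 hl.symm) hk hdeg hev
  obtain ⟨κ, hκ, hcoef⟩ := betheCoeff_eq hy hpt ht
  have huv : universalVector y M t = κ • betheSum M k (fun i => (-1) ^ i * c i) := by
    rw [universalVector, ← betheSum_smul]
    refine betheSum_congr fun j hj => hcoef j ?_
    rw [Finset.mem_Icc] at hj
    omega
  refine ⟨?_, κ, hκ, huv⟩
  rw [huv]
  exact smul_ne_zero hκ (betheSum_ne_zero hi (mul_ne_zero (pow_ne_zero _ (by norm_num)) hci))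

/-! ### The common line of the three vectors and of the Bethe vectors -/

theorem corollary6p4
    (l z : Fin 2 → ℂ) (n m : Fin 2 → ℕ) (hnm : n 0 + n 1 = m 0 + m 1)
    (p q : Fin 2 → ℂ[X]) (V U : Submodule ℂ (ℂ → ℂ))
    (hp : ∀ i, (p i).degree = (n i : WithBot ℕ)) (hVp : V = quasiSpace l p)
    (hV : IsSpecialSpace l z n m V)
    (hU : U = specialDual 2 z V)
    (hq : ∀ a, (q a).degree = (m a : WithBot ℕ)) (hUq : U = quasiSpace z q)
    (c d e : ℕ → ℂ)
    (hc : p 1 = twoPointPoly z (n 1) c)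
    (hd : p 0 = twoPointPoly z (n 0) d)
    (he : q 1 = twoPointPoly l (m 1) e) :
    -- the Weyl and duality isomorphisms relate the three weight subspaces
    ((weightSpace m n).map weylIso.toLinearMap = weightSpace m (swapPair n) ∧
      (weightSpace n m).map dualityIso.toLinearMap = weightSpace m n) ∧
    -- the three vectors lie in them
    (betheSum m (n 1) c ∈ weightSpace m n ∧
      betheSum m (n 0) d ∈ weightSpace m (swapPair n) ∧
      betheSum n (m 1) e ∈ weightSpace n m) ∧
    -- after identification they lie on a common line, and are nonzero in the admissible case
    (∃ w ∈ weightSpace m n, w ≠ 0 ∧ ∃ κ₁ κ₂ κ₃ : ℂ,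
      betheSum m (n 1) c = κ₁ • w ∧
      betheSum m (n 0) d = κ₂ • weylIso w ∧
      dualityIso (betheSum n (m 1) e) = κ₃ • w ∧
      ((∀ a, (p 1).eval (z a) ≠ 0) → κ₁ ≠ 0) ∧
      ((∀ a, (p 0).eval (z a) ≠ 0) → κ₂ ≠ 0) ∧
      ((∀ i, (q 1).eval (l i) ≠ 0) → κ₃ ≠ 0)) ∧
    -- admissible root tuples are critical points, and their universal vectors are proportional to
    -- the vectors above with the signs `(-1)^i` inserted in the coefficients
    (∀ t : Fin (n 1) → ℂ, Represents (p 1) t → IsAdmissible z t →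
      IsCriticalPoint l z m t ∧ universalVector z m t ≠ 0 ∧
      ∃ κ : ℂ, κ ≠ 0 ∧ universalVector z m t = κ • betheSum m (n 1) (fun i => (-1) ^ i * c i)) ∧
    (∀ s : Fin (n 0) → ℂ, Represents (p 0) s → IsAdmissible z s →
      IsCriticalPoint (swapPair l) z m s ∧ universalVector z m s ≠ 0 ∧
      ∃ κ : ℂ, κ ≠ 0 ∧ universalVector z m s = κ • betheSum m (n 0) (fun i => (-1) ^ i * d i)) ∧
    (∀ r : Fin (m 1) → ℂ, Represents (q 1) r → IsAdmissible l r →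
      IsCriticalPoint z l n r ∧ universalVector l n r ≠ 0 ∧
      ∃ κ : ℂ, κ ≠ 0 ∧ universalVector l n r = κ • betheSum n (m 1) (fun i => (-1) ^ i * e i)) ∧
    -- the Bethe vectors are identified up to proportionality
    (∀ (t : Fin (n 1) → ℂ) (s : Fin (n 0) → ℂ), Represents (p 1) t → IsAdmissible z t →
      Represents (p 0) s → IsAdmissible z s →
      ∃ κ : ℂ, κ ≠ 0 ∧ weylIso (universalVector z m t) = κ • universalVector z m s) ∧
    (∀ (t : Fin (n 1) → ℂ) (r : Fin (m 1) → ℂ), Represents (p 1) t → IsAdmissible z t →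
      Represents (q 1) r → IsAdmissible l r →
      ∃ κ : ℂ, κ ≠ 0 ∧ dualityIso (universalVector l n r) = κ • universalVector z m t) := by
  subst hVp hU
  have hl : l 0 ≠ l 1 := hV.l_injective.ne (by decide)
  have hz : z 0 ≠ z 1 := hV.z_injective.ne (by decide)
  have hδ : l 1 - l 0 ≠ 0 := sub_ne_zero.2 hl.symm
  have hδ' : l 0 - l 1 ≠ 0 := sub_ne_zero.2 hl
  have hZ : z 1 - z 0 ≠ 0 := sub_ne_zero.2 hz.symm
  obtain ⟨K, hK⟩ := exists_wronskianPoly_eq hnm hp hV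
  obtain ⟨E, h₁, h₀⟩ := exists_solvesHeun hnm hp hV
  have hq₁ : SolvesHeun l n (z 1 - z 0) (m 1) E (q 1) := by
    refine solvesHeun_of_solvesDual hnm (solvesDual_of_mem_specialDual hz hnm hK h₁ h₀ ?_)
    rw [hUq]
    exact Submodule.subset_span ⟨1, rfl⟩
  have r₁ := (solvesHeun_twoPointPoly_iff hz).1 (hc ▸ h₁)
  have r₀ := (solvesHeun_twoPointPoly_iff hz).1 (hd ▸ h₀)
  have r₂ := (solvesHeun_twoPointPoly_iff hl).1 (he ▸ hq₁)
  -- All three sequences live on the block for `(m, n 1)`; `d` is read backwards from `m 1`, as the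
  -- Weyl map prescribes.
  obtain ⟨x, hx, hS⟩ := exists_common_solution (M := m) (ε := (l 1 - l 0) * (z 1 - z 0))
    (k := n 1) (E := E) {c, fun j => d (m 1 - j), e} (by
      rintro y (rfl | rfl | rfl) i h1 h2
      · exact r₁ i (by omega)
      · rw [heunRec_reverse hnm _ _ _ (by omega), ← r₀ (m 1 - i) (by omega)]
        congr 1 <;> ring
      · rw [← heunRec_dual hnm, ← r₂ i (by omega), mul_comm])
  set i₀ := n 1 - m 0 with hi₀
  have hSc := hS c (by simp)
  have hSd := hS (fun j => d (m 1 - j)) (by simp)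
  have hSe := hS e (by simp)
  have hi₀mem : i₀ ∈ Finset.Icc (n 1 - m 0) (min (m 1) (n 1)) :=
    Finset.mem_Icc.2 ⟨le_rfl, by omega⟩
  have hI : Finset.Icc (m 1 - n 0) (min (n 1) (m 1)) = Finset.Icc i₀ (min (m 1) (n 1)) := by
    rw [min_comm]; congr 1; omega
  have hSd' : ∀ j ∈ Finset.Icc (n 0 - m 0) (min (m 1) (n 0)),
      d j = d (m 1 - i₀) * x (m 1 - j) := by
    intro j hj
    rw [Finset.mem_Icc] at hj
    have := hSd (m 1 - j) (Finset.mem_Icc.2 ⟨by omega, by omega⟩)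
    rwa [show m 1 - (m 1 - j) = j by omega] at this
  set ρ : ℂ := ((n 0).factorial * (n 1).factorial : ℂ) / ((m 0).factorial * (m 1).factorial)
    with hρ
  have hρ0 : ρ ≠ 0 := by
    have hf : ∀ j : ℕ, (j.factorial : ℂ) ≠ 0 := fun j => by exact_mod_cast j.factorial_ne_zero
    exact div_ne_zero (mul_ne_zero (hf _) (hf _)) (mul_ne_zero (hf _) (hf _))
  -- The common vector with signs inserted. Reversal turns `(-1) ^ i` into `(-1) ^ (m 1 - i)`, so
  -- the signs survive the Weyl map up to the global factor `(-1) ^ m 1`.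
  set v := betheSum m (n 1) (fun i => (-1) ^ i * x i) with hv
  have vt : betheSum m (n 1) (fun i => (-1) ^ i * c i) = c i₀ • v := by
    rw [hv, ← betheSum_smul]
    exact betheSum_congr fun i hi => by rw [hSc i hi]; ring
  have vs : betheSum m (n 0) (fun i => (-1) ^ i * d i) =
      (d (m 1 - i₀) * (-1) ^ m 1) • weylIso v := by
    rw [hv, weylIso_betheSum hnm, ← betheSum_smul]
    refine betheSum_congr fun j hj => ?_
    rw [hSd' j hj]
    rw [Finset.mem_Icc] at hj
    have hs : ((-1 : ℂ)) ^ m 1 * (-1) ^ (m 1 - j) = (-1) ^ j := by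
      obtain ⟨b, hb⟩ : ∃ b, m 1 = j + b := ⟨m 1 - j, by omega⟩
      rw [hb, Nat.add_sub_cancel_left, pow_add, mul_assoc, ← mul_pow]
      simp
    linear_combination -(d (m 1 - i₀) * x (m 1 - j)) * hs
  have vr : dualityIso (betheSum n (m 1) (fun i => (-1) ^ i * e i)) = (ρ * e i₀) • v := by
    rw [dualityIso_betheSum hnm, ← hρ, hv, mul_smul, ← betheSum_smul m (n 1) (e i₀)]
    congr 1
    exact betheSum_congr fun i hi => by rw [hSe i hi]; ring
  have Bt := fun t => bethe_of_solvesHeun hl hz h₁ (hp 1) (by omega) hc (t := t)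
  have Bs := fun t => bethe_of_solvesHeun (l := swapPair l) hl.symm hz h₀ (hp 0) (by omega) hd
    (t := t)
  have Br := fun t => bethe_of_solvesHeun hz hl hq₁ (hq 1) (by omega) he (t := t)
  refine ⟨⟨map_weylIso_weightSpace m n, map_dualityIso_weightSpace m n⟩,
    ⟨betheSum_mem hnm c, betheSum_mem (n := swapPair n) (by simp [swapPair]; omega) d,
      betheSum_mem hnm.symm e⟩,
    ⟨betheSum m (n 1) x, betheSum_mem hnm x, betheSum_ne_zero hi₀mem (by rw [hx]; exact one_ne_zero),
      c i₀, d (m 1 - i₀), ρ * e i₀, ?_, ?_, ?_, ?_, ?_, ?_⟩, Bt, Bs, Br, ?_, ?_⟩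
  · rw [← betheSum_smul]
    exact betheSum_congr hSc
  · rw [weylIso_betheSum hnm, ← betheSum_smul]
    exact betheSum_congr hSd'
  · rw [dualityIso_betheSum hnm, ← hρ, mul_smul, ← betheSum_smul m (n 1) (e i₀)]
    congr 1
    exact betheSum_congr hSe
  · intro hne h0
    rw [hc] at hne h₁
    obtain ⟨i, hi, hci⟩ := h₁.exists_coeff_ne_zero hz hδ (by omega) (hc ▸ hp 1) hne
    exact hci (by rw [hSc i hi, h0, zero_mul])
  · intro hne h0
    rw [hd] at hne h₀
    obtain ⟨i, hi, hci⟩ := h₀.exists_coeff_ne_zero hz hδ' (by omega) (hd ▸ hp 0) hne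
    exact hci (by rw [hSd' i hi, h0, zero_mul])
  · intro hne
    rw [he] at hne hq₁
    obtain ⟨i, hi, hci⟩ := hq₁.exists_coeff_ne_zero hl hZ (by omega) (he ▸ hq 1) hne
    refine mul_ne_zero hρ0 fun h0 => hci ?_
    rw [hI] at hi
    rw [hSe i hi, h0, zero_mul]
  · intro t s ht ht' hs hs'
    obtain ⟨-, hωt, a, ha, hta⟩ := Bt t ht ht'
    obtain ⟨-, hωs, b, hb, hsb⟩ := Bs s hs hs'
    rw [hta, vt] at hωt ⊢
    rw [hsb, vs] at hωs ⊢
    rw [smul_smul] at hωt hωs ⊢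
    -- Each Bethe vector is a scalar times `v` or its Weyl image, so its being nonzero makes the
    -- scalar invertible.
    have h1 := left_ne_zero_of_smul hωt
    have h2 := left_ne_zero_of_smul hωs
    refine ⟨a * c i₀ / (b * (d (m 1 - i₀) * (-1) ^ m 1)), div_ne_zero h1 h2, ?_⟩
    simp only [map_smul, smul_smul]
    congr 1
    linear_combination -(div_mul_cancel₀ (a * c i₀) h2)
  · intro t r ht ht' hr hr'
    obtain ⟨-, hωt, a, ha, hta⟩ := Bt t ht ht'
    obtain ⟨-, hωr, b, hb, hrb⟩ := Br r hr hr'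
    rw [← dualityIso.map_ne_zero_iff] at hωr
    rw [hta, vt] at hωt ⊢
    rw [hrb, map_smul, vr] at hωr ⊢
    rw [smul_smul] at hωt hωr ⊢
    have h1 := left_ne_zero_of_smul hωt
    have h2 := left_ne_zero_of_smul hωr
    refine ⟨b * (ρ * e i₀) / (a * c i₀), div_ne_zero h2 h1, ?_⟩
    simp only [smul_smul]
    congr 1
    linear_combination -(div_mul_cancel₀ (b * (ρ * e i₀)) h1)
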